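/- A timed automaton $\mathcal A=(L,X,E,\mathcal I)$ has finite sets of locations $L$, clocks $X$ and edges $e=(\ell,g,Y,\ell')$, where $g$ and the invariants $\mathcal I(\ell)$ are finite conjunctions of constraints $x\sim c$ ($x\in X$, $c\in\mathbb N$, $\sim\in\{<,\le,=,\ge,>\}$) and $Y\subseteq X$ is the set of reset clocks. States are the pairs $(\ell,v)$ with $v\in\mathbb R_+^X$, $v\models\mathcal I(\ell)$. There is a transition $(\ell,v)\xrightarrow{t,e}(\ell',[Y\leftarrow0](v+t))$ along $e=(\ell,g,Y,\ell')$ iff $v+t'\models\mathcal I(\ell)$ for all $0\le t'\le t$, $v+t\models g$ and $[Y\leftarrow 0](v+t)\models\mathcal I(\ell')$. Let $I(s,e)$ be the set of delays $t$ after which $e$ can be taken from $s$, $I(s)=\bigcup_e I(s,e)$, and assume $I(s)\ne\emptyset$ for every state $s$. Let $M$ be the maximal constant used in $\mathcal A$ ($M=0$ if there is none). A stochastic timed automaton adds positive edge weights $w$ and, for every state $s$, a probability measure $\mu_s$ on $\mathbb R_+$, depending measurably on $s$, with $\mu_s(I(s))=1$; $\mu_s$ is equivalent to Lebesgue measure on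 $I(s)$ if $I(s)$ has positive Lebesgue measure, and to the uniform distribution on the (finitely many) points of $I(s)$ otherwise. $\mathbb P_{s}$ is the probability measure on infinite runs from $s$ under which, in each state $s_n$, the delay $t$ is drawn from $\mu_{s_n}$ and then an edge is drawn among those enabled without further delay in $s_n+t$, with probabilities proportional to $w$. Regions are the classes of the usual region equivalence with maximal constant $M$: $v\equiv v'$ iff for every $x$ either $v(x),v'(x)>M$, or $\lfloor v(x)\rfloor=\lfloor v'(x)\rfloor$ and ($\{v(x)\}=0$ iff $\{v'(x)\}=0$); and for all $x,y$ with $v(x),v(y)\le M$, $\{v(x)\}\le\{v(y)\}$ iff $\{v'(x)\}\le\{v'(y)\}$. The region automaton has locations $(\ell,r)$, $r$ a region, and an edge $f$ from $(\ell,r)$ to $(\ell',r')$ labelled $(r'',e)$ whenever there are $v\in r$ and a transition $(\ell,v)\xrightarrow{t,e}(\ell',v')$ with $v+t\in r''$, $v'\in r'$; such a transition of $\mathcal A$ is said to be along $f$. Let $I(s,f)$ be the set of delays of the transitions from $s$ along $f$. The edge $f$ is thick if $\dim I(s,f)=\dim I(s)$ for the states $s$ in its source. A run $s_0\xrightarrow{t_1,e_1}s_1\xrightarrow{t_2,e_2}\cdots$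 is fair if every thick $f$ whose source contains $s_n$ for infinitely many $n$ is taken infinitely often (infinitely many transitions of the run are along $f$). The automaton is almost-surely fair from $s$ if $\mathbb P_s(\text{fair})=1$. The stochastic timed automaton is *reactive* if $I(s)=\mathbb R_+$ for every state $s$ and for every $\ell\in L$ there is a probability distribution $\mu_\ell$ on $\mathbb R_+$, equivalent to Lebesgue measure, with $\mu_{(\ell,v)}=\mu_\ell$ for all states $(\ell,v)$. Let $L_u$ be the set of $\ell\in L$ such that $I(\ell,v)$ is unbounded for all $v\models\mathcal I(\ell)$, and $L_b=L\setminus L_u$. It is *weak reactive* if 1. $\mu_{(\ell,v)}=\mu_{(\ell,v')}$ for all states $(\ell,v)$, $(\ell,v')$ such that, for every $x\in X$, $v(x)=v'(x)$ or $\min(v(x),v'(x))>M$; 2. there is $0<\lambda_0\le1$ with $\mu_s([M,\infty))\ge\lambda_0$ for every state $s$ with location in $L_u$; 3. there are $0<\lambda_1\le1$ and $N\ge1$ such that for every state $s$ with location in $L_b$, the $\mathbb P_s$-probability that the target of the $i$-th edge of the run is in $L_u$ for some $1\le i<N$ is at least $\lambda_1$. **Proposition.** Every weak reactive stochastic timed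 automaton is almost-surely fair from every state. Every reactive stochastic timed automaton is weak reactive; in particular it is almost-surely fair from every state. -/

import Mathlib

open MeasureTheory ProbabilityTheory Filter
open scoped NNReal ENNReal

namespace STA

noncomputable section

/-! ## Guards, valuations, timed automata -/

/-- The comparison symbols `<`, `≤`, `=`, `≥`, `>`. -/
inductive Cmp
  | lt
  | le
  | eq
  | ge
  | gt

/-- `a ∼ c`, for a nonnegative real `a` and a natural number `c`. -/
def Cmp.Holds : Cmp → ℝ≥0 → ℕ → Prop
  | .lt, a, c => a < c
  | .le, a, c => a ≤ c
  | .eq, a, c => a = c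
  | .ge, a, c => (c : ℝ≥0) ≤ a
  | .gt, a, c => (c : ℝ≥0) < a

/-- An atomic constraint `x ∼ c`. -/
structure AtomicConstraint (X : Type*) where
  clock : X
  cmp : Cmp
  const : ℕ

/-- A guard: a finite conjunction of atomic constraints. -/
abbrev Guard (X : Type*) := List (AtomicConstraint X)

/-- Clock valuations. -/
abbrev Valuation (X : Type*) := X → ℝ≥0

/-- `v ⊨ g`. -/
def Sat {X : Type*} (v : Valuation X) (g : Guard X) : Prop :=
  ∀ a ∈ g, a.cmp.Holds (v a.clock) a.const

/-- The largest constant of a guard (`0` if there is none). -/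
def guardMax {X : Type*} (g : Guard X) : ℕ := (g.map AtomicConstraint.const).foldr max 0

/-- The valuation `v + t`. -/
def elapse {X : Type*} (v : Valuation X) (t : ℝ≥0) : Valuation X := fun x => v x + t

open Classical in
/-- The valuation `[Y ← 0] v`. -/
def reset {X : Type*} (Y : Set X) (v : Valuation X) : Valuation X :=
  fun x => if x ∈ Y then 0 else v x

/-- Elements of `L × 𝒢(X) × 2^X × L`. -/
structure Edge (L X : Type*) where
  source : L
  guard : Guard X
  resets : Set X
  target : L

/-- A timed automaton with locations `L` and clocks `X`. The labelling by atomic propositions is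
omitted: nothing below depends on it. -/
structure TimedAutomaton (L X : Type*) where
  edges : Finset (Edge L X)
  inv : L → Guard X

namespace TimedAutomaton

variable {L X : Type*}

/-- The (finite) type of edges of `A`. -/
def E (A : TimedAutomaton L X) : Type _ := {e : Edge L X // e ∈ A.edges}

instance (A : TimedAutomaton L X) : Fintype A.E :=
  inferInstanceAs (Fintype {e : Edge L X // e ∈ A.edges})

instance (A : TimedAutomaton L X) : MeasurableSpace A.E := ⊤

instance (A : TimedAutomaton L X) : DiscreteMeasurableSpace A.E := ⟨fun _ => trivial⟩

/-- The states `(ℓ, v)`, with `v ⊨ ℐ(ℓ)`. -/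
@[ext]
structure State (A : TimedAutomaton L X) where
  loc : L
  val : Valuation X
  sat : Sat val (A.inv loc)

/-- The Borel σ-algebra on valuations, with the discrete one on locations. -/
instance (A : TimedAutomaton L X) : MeasurableSpace A.State :=
  MeasurableSpace.comap (fun s => (s.loc, s.val))
    (@Prod.instMeasurableSpace L (Valuation X) ⊤ inferInstance)

/-- The maximal constant used in guards and invariants (`0` if there is none). -/
def maxConst [Fintype L] (A : TimedAutomaton L X) : ℕ :=
  max (A.edges.sup fun e => guardMax e.guard) (Finset.univ.sup fun ℓ => guardMax (A.inv ℓ))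

/-- The transition `s --(t, e)--> s'`. -/
def Trans (A : TimedAutomaton L X) (s : A.State) (t : ℝ≥0) (e : A.E) (s' : A.State) : Prop :=
  e.1.source = s.loc ∧ (∀ t' ≤ t, Sat (elapse s.val t') (A.inv s.loc)) ∧
    Sat (elapse s.val t) e.1.guard ∧
    s'.loc = e.1.target ∧ s'.val = reset e.1.resets (elapse s.val t)

/-- `I(s, e)`: the delays after which `e` can be taken from `s`. -/
def delaysVia (A : TimedAutomaton L X) (s : A.State) (e : A.E) : Set ℝ≥0 :=
  {t | ∃ s', A.Trans s t e s'}

/-- `I(s) = ⋃ₑ I(s, e)`. -/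
def delays (A : TimedAutomaton L X) (s : A.State) : Set ℝ≥0 := ⋃ e, A.delaysVia s e

/-- `A` is reactive: every delay is possible from every state. -/
def IsReactive (A : TimedAutomaton L X) : Prop := ∀ s : A.State, A.delays s = Set.univ

open Classical in
/-- The state `s + t` (by convention `s`, if the invariant is violated at `s + t`). -/
def shift (A : TimedAutomaton L X) (s : A.State) (t : ℝ≥0) : A.State :=
  if h : Sat (elapse s.val t) (A.inv s.loc) then ⟨s.loc, elapse s.val t, h⟩ else s

open Classical in
/-- The state reached from `s` by delaying `t` and then taking `e` (by convention `s`, if that is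
not possible). -/
def next (A : TimedAutomaton L X) (s : A.State) (t : ℝ≥0) (e : A.E) : A.State :=
  if h : ∃ s', A.Trans s t e s' then h.choose else s

/-! ## Regions and the timed region automaton -/

/-- Region equivalence of valuations. -/
def RegionEquiv [Fintype L] (A : TimedAutomaton L X) (v v' : Valuation X) : Prop :=
  (∀ x, ((A.maxConst : ℝ≥0) < v x ∧ (A.maxConst : ℝ≥0) < v' x) ∨
    (⌊v x⌋₊ = ⌊v' x⌋₊ ∧ (Int.fract (v x : ℝ) = 0 ↔ Int.fract (v' x : ℝ) = 0))) ∧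
  (∀ x y, v x ≤ A.maxConst → v y ≤ A.maxConst →
    (Int.fract (v x : ℝ) ≤ Int.fract (v y : ℝ) ↔ Int.fract (v' x : ℝ) ≤ Int.fract (v' y : ℝ)))

lemma le_iff_of_floor_eq {M : ℕ} {a b : ℝ≥0} (h1 : ⌊a⌋₊ = ⌊b⌋₊)
    (h2 : Int.fract (a : ℝ) = 0 ↔ Int.fract (b : ℝ) = 0) : a ≤ M ↔ b ≤ M := by
  have key : ∀ {a b : ℝ≥0}, ⌊a⌋₊ = ⌊b⌋₊ →
      (Int.fract (a : ℝ) = 0 ↔ Int.fract (b : ℝ) = 0) → a ≤ M → b ≤ M := by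
    intro a b h1 h2 ha
    rcases lt_or_eq_of_le ha with h | h
    · have : ⌊a⌋₊ < M := (Nat.floor_lt' (by rintro rfl; simp at h)).2 h
      rw [h1] at this
      exact ((Nat.floor_lt' (by omega)).1 this).le
    · have hb : Int.fract (b : ℝ) = 0 := h2.1 (by rw [h]; simp)
      have hfl : ⌊b⌋₊ = M := by rw [← h1, h]; simp
      rw [Int.fract_eq_iff] at hb
      obtain ⟨z, hz⟩ := hb.2.2
      have hz0 : (0 : ℝ) ≤ z := by rw [← hz]; simp
      lift z to ℕ using (by exact_mod_cast hz0)
      have hbz : b = z := by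
        apply NNReal.coe_injective
        simpa using hz
      rw [hbz] at hfl ⊢
      simp at hfl
      simp [hfl]
  exact ⟨key h1 h2, key h1.symm h2.symm⟩

lemma RegionEquiv.le_iff [Fintype L] {A : TimedAutomaton L X} {v v' : Valuation X}
    (h : A.RegionEquiv v v') (x : X) : v x ≤ A.maxConst ↔ v' x ≤ A.maxConst := by
  rcases h.1 x with ⟨h1, h2⟩ | ⟨h1, h2⟩
  · simp [not_le.2 h1, not_le.2 h2]
  · exact le_iff_of_floor_eq h1 h2

lemma regionEquiv_equivalence [Fintype L] (A : TimedAutomaton L X) :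
    Equivalence A.RegionEquiv where
  refl v := ⟨fun x => Or.inr ⟨rfl, Iff.rfl⟩, fun _ _ _ _ => Iff.rfl⟩
  symm {v v'} h := by
    refine ⟨fun x => ?_, fun x y hx hy => ?_⟩
    · rcases h.1 x with ⟨h1, h2⟩ | ⟨h1, h2⟩
      · exact Or.inl ⟨h2, h1⟩
      · exact Or.inr ⟨h1.symm, h2.symm⟩
    · exact (h.2 x y ((h.le_iff x).2 hx) ((h.le_iff y).2 hy)).symm
  trans {u v w} h k := by
    refine ⟨fun x => ?_, fun x y hx hy => ?_⟩
    · rcases h.1 x with ⟨h1, h2⟩ | ⟨h1, h2⟩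
      · rcases k.1 x with ⟨k1, k2⟩ | ⟨k1, k2⟩
        · exact Or.inl ⟨h1, k2⟩
        · exact Or.inl ⟨h1, not_le.1 fun hw => not_le.2 h2 ((k.le_iff x).2 hw)⟩
      · rcases k.1 x with ⟨k1, k2⟩ | ⟨k1, k2⟩
        · exact Or.inl ⟨not_le.1 fun hu => not_le.2 k1 ((h.le_iff x).1 hu), k2⟩
        · exact Or.inr ⟨h1.trans k1, h2.trans k2⟩
    · exact (h.2 x y hx hy).trans (k.2 x y ((h.le_iff x).1 hx) ((h.le_iff y).1 hy))

/-- Region equivalence as a setoid. -/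
def regionSetoid [Fintype L] (A : TimedAutomaton L X) : Setoid (Valuation X) :=
  ⟨A.RegionEquiv, A.regionEquiv_equivalence⟩

/-- The regions of `A`. -/
def Region [Fintype L] (A : TimedAutomaton L X) : Type _ := Quotient A.regionSetoid

/-- The region `[v]` of a valuation. -/
def region [Fintype L] (A : TimedAutomaton L X) (v : Valuation X) : A.Region :=
  Quotient.mk A.regionSetoid v

/-- The locations `(ℓ, r)` of the timed region automaton. -/
abbrev RegionState [Fintype L] (A : TimedAutomaton L X) : Type _ := L × A.Region

/-- The location `(ℓ, [v])` of the timed region automaton given by a state `(ℓ, v)`. -/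
def regionState [Fintype L] (A : TimedAutomaton L X) (s : A.State) : A.RegionState :=
  (s.loc, A.region s.val)

/-- The edges `(ℓ, r) --(guard(r''), e, Y)--> (ℓ', r')` of the timed region automaton: there are
`v ∈ r` and a transition `(ℓ, v) --(t, e)--> (ℓ', v')` with `v + t ∈ r''` and `v' ∈ r'`.
(`Y` is the reset set of `e`.) -/
@[ext]
structure RegionEdge [Fintype L] (A : TimedAutomaton L X) where
  source : A.RegionState
  mid : A.Region
  edge : A.E
  target : A.RegionState
  exists_trans : ∃ s t s', A.Trans s t edge s' ∧ A.regionState s = source ∧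
    A.region (elapse s.val t) = mid ∧ A.regionState s' = target

/-- The transition `s --(t, e)--> s'` of `A` is a transition along the edge `f` in the timed region
automaton. -/
def TransAlong [Fintype L] (A : TimedAutomaton L X) (f : A.RegionEdge)
    (s : A.State) (t : ℝ≥0) (e : A.E) (s' : A.State) : Prop :=
  A.Trans s t e s' ∧ f.edge = e ∧ f.source = A.regionState s ∧
    f.mid = A.region (elapse s.val t) ∧ f.target = A.regionState s'

/-- `I(s, f)` for an edge `f` of the timed region automaton. -/
def regionDelaysVia [Fintype L] (A : TimedAutomaton L X) (s : A.State) (f : A.RegionEdge) :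
    Set ℝ≥0 :=
  {t | ∃ s', A.TransAlong f s t f.edge s'}

/-- The dimension (`0` or `1`) of a nonempty finite union of intervals of `[0, ∞)`. -/
def dim (S : Set ℝ≥0) : ℕ :=
  open Classical in if (interior S).Nonempty then 1 else 0

/-- An edge of the timed region automaton with source `q` is thin if `dim I(s, f) < dim I(s)` for
some (equivalently, every) state `s` in `q`. -/
def RegionEdge.IsThin [Fintype L] {A : TimedAutomaton L X} (f : A.RegionEdge) : Prop :=
  ∃ s : A.State, A.regionState s = f.source ∧ dim (A.regionDelaysVia s f) < dim (A.delays s)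

/-- An edge is thick if it is not thin. -/
def RegionEdge.IsThick [Fintype L] {A : TimedAutomaton L X} (f : A.RegionEdge) : Prop :=
  ¬ f.IsThin

/-! ## Runs -/

/-- `(s, t, e)`: a state, the delay spent there, and the edge taken afterwards. -/
abbrev Config (A : TimedAutomaton L X) : Type _ := A.State × ℝ≥0 × A.E

/-- The infinite runs `s₀ --(t₁, e₁)--> s₁ --(t₂, e₂)--> s₂ ⋯` from `s`, given as the sequences
`n ↦ (sₙ, tₙ₊₁, eₙ₊₁)`. -/
def runs (A : TimedAutomaton L X) (s : A.State) : Set (ℕ → A.Config) :=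
  {ρ | (ρ 0).1 = s ∧ ∀ n, A.Trans (ρ n).1 (ρ n).2.1 (ρ n).2.2 (ρ (n + 1)).1}

/-- The cylinder generated by the symbolic path `π(s, e₁ … e_N)`. -/
def cyl (A : TimedAutomaton L X) (s : A.State) {N : ℕ} (es : Fin N → A.E) : Set (ℕ → A.Config) :=
  {ρ | ρ ∈ A.runs s ∧ ∀ i : Fin N, (ρ i).2.2 = es i}

/-- A run is fair if every thick edge of the timed region automaton that is enabled in infinitely
many of the visited locations of the timed region automaton is taken infinitely often (in the
image of the run in the timed region automaton). -/
def IsFair [Fintype L] (A : TimedAutomaton L X) (ρ : ℕ → A.Config) : Prop :=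
  ∀ f : A.RegionEdge, f.IsThick → (∃ᶠ n in atTop, f.source = A.regionState (ρ n).1) →
    ∃ᶠ n in atTop, A.TransAlong f (ρ n).1 (ρ n).2.1 (ρ n).2.2 (ρ (n + 1)).1

end TimedAutomaton

/-! ## Measurability -/

section Measurability

namespace TimedAutomaton

variable {L X : Type*}

lemma measurableSet_sat {Ω X : Type*} [MeasurableSpace Ω] {f : Ω → Valuation X}
    (hf : ∀ x, Measurable fun ω => f ω x) (g : Guard X) : MeasurableSet {ω | Sat (f ω) g} := by
  have : {ω | Sat (f ω) g} = ⋂ a ∈ {a | a ∈ g}, {ω | a.cmp.Holds (f ω a.clock) a.const} := by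
    ext ω; simp [Sat]
  rw [this]
  refine MeasurableSet.biInter (List.finite_toSet g).countable fun a _ => ?_
  rcases a with ⟨x, c, n⟩
  cases c
  · exact measurableSet_lt (hf x) measurable_const
  · exact measurableSet_le (hf x) measurable_const
  · exact measurableSet_eq_fun (hf x) measurable_const
  · exact measurableSet_le measurable_const (hf x)
  · exact measurableSet_lt measurable_const (hf x)

lemma Cmp.holds_between {c : Cmp} {n : ℕ} {a b d : ℝ≥0} (h1 : c.Holds a n) (h2 : c.Holds d n)
    (hab : a ≤ b) (hbd : b ≤ d) : c.Holds b n := by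
  cases c
  · exact hbd.trans_lt h2
  · exact hbd.trans h2
  · exact le_antisymm (hbd.trans h2.le) (h1.symm.le.trans hab)
  · exact le_trans h1 hab
  · exact lt_of_lt_of_le h1 hab

lemma sat_between {v : Valuation X} {g : Guard X} (hv : Sat v g) {t t' : ℝ≥0} (h : t' ≤ t)
    (ht : Sat (elapse v t) g) : Sat (elapse v t') g := fun a ha =>
  Cmp.holds_between (hv a ha) (ht a ha) (by simp [elapse]) (by simp only [elapse]; gcongr)

variable {A : TimedAutomaton L X}

lemma measurable_state_iff [Countable L] {Ω : Type*} [MeasurableSpace Ω] {f : Ω → A.State} :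
    Measurable f ↔
      (∀ ℓ, MeasurableSet {ω | (f ω).loc = ℓ}) ∧ ∀ x, Measurable fun ω => (f ω).val x := by
  let _ : MeasurableSpace L := ⊤
  have _ : DiscreteMeasurableSpace L := ⟨fun _ => trivial⟩
  have h1 : Measurable f ↔ Measurable fun ω => ((f ω).loc, (f ω).val) := measurable_comap_iff
  rw [h1]
  constructor
  · exact fun h => ⟨fun ℓ => (measurable_fst.comp h) (measurableSet_singleton ℓ),
      fun x => (measurable_pi_apply x).comp (measurable_snd.comp h)⟩
  · rintro ⟨h1, h2⟩
    exact (measurable_to_countable' (f := fun ω => (f ω).loc) h1).prodMk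
      (measurable_pi_lambda _ h2)

lemma measurable_val [Countable L] (x : X) : Measurable fun s : A.State => s.val x :=
  (measurable_state_iff.1 measurable_id).2 x

lemma measurableSet_loc [Countable L] (ℓ : L) : MeasurableSet {s : A.State | s.loc = ℓ} :=
  (measurable_state_iff.1 measurable_id).1 ℓ

lemma measurable_elapse [Countable L] (x : X) :
    Measurable fun q : A.State × ℝ≥0 => elapse q.1.val q.2 x :=
  ((measurable_val x).comp measurable_fst).add measurable_snd

lemma measurable_reset_elapse [Countable L] (Y : Set X) (x : X) :
    Measurable fun q : A.State × ℝ≥0 => reset Y (elapse q.1.val q.2) x := by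
  by_cases hx : x ∈ Y
  · simp [reset, hx]
  · simpa [reset, hx] using measurable_elapse x

lemma measurableSet_of_loc [Countable L] {P : L → A.State × ℝ≥0 → Prop}
    (h : ∀ ℓ, MeasurableSet {q | P ℓ q}) :
    MeasurableSet {q : A.State × ℝ≥0 | P q.1.loc q} := by
  have : {q : A.State × ℝ≥0 | P q.1.loc q} =
      ⋃ ℓ, (Prod.fst ⁻¹' {s : A.State | s.loc = ℓ}) ∩ {q | P ℓ q} := by
    ext q; simp
  rw [this]
  exact MeasurableSet.iUnion fun ℓ => (measurable_fst (measurableSet_loc ℓ)).inter (h ℓ)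

lemma exists_trans_iff {s : A.State} {t : ℝ≥0} {e : A.E} :
    (∃ s', A.Trans s t e s') ↔ e.1.source = s.loc ∧ Sat (elapse s.val t) (A.inv s.loc) ∧
      Sat (elapse s.val t) e.1.guard ∧
      Sat (reset e.1.resets (elapse s.val t)) (A.inv e.1.target) := by
  constructor
  · rintro ⟨s', h1, h2, h3, h4, h5⟩
    refine ⟨h1, h2 t le_rfl, h3, ?_⟩
    rw [← h4, ← h5]
    exact s'.sat
  · rintro ⟨h1, h2, h3, h4⟩
    exact ⟨⟨e.1.target, reset e.1.resets (elapse s.val t), h4⟩, h1,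
      fun t' ht' => sat_between s.sat ht' h2, h3, rfl, rfl⟩

lemma measurableSet_exists_trans [Countable L] (e : A.E) :
    MeasurableSet {q : A.State × ℝ≥0 | ∃ s', A.Trans q.1 q.2 e s'} := by
  simp only [exists_trans_iff]
  refine ((measurable_fst (measurableSet_loc e.1.source)).congr ?_).inter
    ((measurableSet_of_loc (P := fun ℓ q => Sat (elapse q.1.val q.2) (A.inv ℓ))
      fun ℓ => measurableSet_sat measurable_elapse _).inter
    ((measurableSet_sat measurable_elapse _).inter
      (measurableSet_sat (measurable_reset_elapse _) _)))
  ext q; exact eq_comm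

open Classical in
lemma shift_val (s : A.State) (t : ℝ≥0) : (A.shift s t).val =
    if Sat (elapse s.val t) (A.inv s.loc) then elapse s.val t else s.val := by
  unfold shift; split_ifs <;> rfl

lemma shift_loc (s : A.State) (t : ℝ≥0) : (A.shift s t).loc = s.loc := by
  unfold shift; split_ifs <;> rfl

lemma measurable_shift [Countable L] :
    Measurable fun q : A.State × ℝ≥0 => A.shift q.1 q.2 := by
  classical
  refine measurable_state_iff.2 ⟨fun ℓ => ?_, fun x => ?_⟩
  · simp only [shift_loc]
    exact measurable_fst (measurableSet_loc ℓ)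
  · have : (fun q : A.State × ℝ≥0 => (A.shift q.1 q.2).val x) = fun q =>
        if Sat (elapse q.1.val q.2) (A.inv q.1.loc) then elapse q.1.val q.2 x
        else q.1.val x := by
      ext q; rw [shift_val]; split_ifs <;> rfl
    rw [this]
    exact Measurable.ite (measurableSet_of_loc (P := fun ℓ q => Sat (elapse q.1.val q.2) (A.inv ℓ))
      fun ℓ => measurableSet_sat measurable_elapse _) (measurable_elapse x)
      ((measurable_val x).comp measurable_fst)

lemma next_of_trans {s s' : A.State} {t : ℝ≥0} {e : A.E} (h : A.Trans s t e s') :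
    A.next s t e = s' := by
  have hex : ∃ s', A.Trans s t e s' := ⟨s', h⟩
  have h' := hex.choose_spec
  rw [next, dif_pos hex]
  exact TimedAutomaton.State.ext (h'.2.2.2.1.trans h.2.2.2.1.symm)
    (h'.2.2.2.2.trans h.2.2.2.2.symm)

lemma trans_next {s : A.State} {t : ℝ≥0} {e : A.E} (h : ∃ s', A.Trans s t e s') :
    A.Trans s t e (A.next s t e) := by
  obtain ⟨s', h⟩ := h
  rwa [next_of_trans h]

lemma measurable_next [Countable L] :
    Measurable fun q : A.Config => A.next q.1 q.2.1 q.2.2 := by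
  classical
  have key : ∀ e : A.E, Measurable fun q : A.State × ℝ≥0 => A.next q.1 q.2 e := by
    intro e
    refine measurable_state_iff.2 ⟨fun ℓ => ?_, fun x => ?_⟩
    · have : {q : A.State × ℝ≥0 | (A.next q.1 q.2 e).loc = ℓ} =
          {q | ((∃ s', A.Trans q.1 q.2 e s') ∧ e.1.target = ℓ) ∨
            (¬ (∃ s', A.Trans q.1 q.2 e s') ∧ q.1.loc = ℓ)} := by
        ext q
        by_cases h : ∃ s', A.Trans q.1 q.2 e s'
        · simp [h, (trans_next h).2.2.2.1]
        · simp only [next, dif_neg h, Set.mem_ofPred_eq]; tauto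
      rw [this]
      exact ((measurableSet_exists_trans e).inter (.const _)).union
        ((measurableSet_exists_trans e).compl.inter (measurable_fst (measurableSet_loc ℓ)))
    · have : (fun q : A.State × ℝ≥0 => (A.next q.1 q.2 e).val x) = fun q =>
          if ∃ s', A.Trans q.1 q.2 e s' then reset e.1.resets (elapse q.1.val q.2) x
          else q.1.val x := by
        ext q
        by_cases h : ∃ s', A.Trans q.1 q.2 e s'
        · simp [h, (trans_next h).2.2.2.2]
        · simp [h, next]
      rw [this]
      exact Measurable.ite (measurableSet_exists_trans e) (measurable_reset_elapse _ x)
        ((measurable_val x).comp measurable_fst)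
  have h2 : Measurable fun q : (A.State × ℝ≥0) × A.E => A.next q.1.1 q.1.2 q.2 :=
    measurable_from_prod_countable_left key
  exact h2.comp (by fun_prop : Measurable fun q : A.Config => ((q.1, q.2.1), q.2.2))

end TimedAutomaton

end Measurability


/-! ## Stochastic timed automata -/

/-- Lebesgue measure on `[0, ∞)`. -/
def lebesgue : Measure ℝ≥0 := (volume : Measure ℝ).comap ((↑) : ℝ≥0 → ℝ)

/-- Two measures are equivalent if they have the same null sets. -/
def MeasEquiv (m m' : Measure ℝ≥0) : Prop := m ≪ m' ∧ m' ≪ m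

/-- A stochastic timed automaton on `A`: delay distributions `μ_s`, depending measurably on the
state `s`, and positive weights of the edges. (The first two conditions force `A` to be
non-blocking.) -/
structure StochasticTA {L X : Type*} (A : TimedAutomaton L X) where
  μ : Kernel A.State ℝ≥0
  μ_univ : ∀ s, μ s Set.univ = 1
  μ_delays : ∀ s, μ s (A.delays s) = 1
  μ_of_pos : ∀ s, 0 < lebesgue (A.delays s) → MeasEquiv (μ s) (lebesgue.restrict (A.delays s))
  μ_of_zero : ∀ s, lebesgue (A.delays s) = 0 → MeasEquiv (μ s) (uniformOn (A.delays s))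
  w : A.E → ℝ≥0
  w_pos : ∀ e, 0 < w e

namespace StochasticTA

variable {L X : Type*} {A : TimedAutomaton L X}

instance (S : StochasticTA A) : IsMarkovKernel S.μ := ⟨fun s => ⟨S.μ_univ s⟩⟩

open Classical in
/-- The total weight of the edges enabled (without delay) in `s`. -/
def enabledWeight (S : StochasticTA A) (s : A.State) : ℝ≥0∞ :=
  ∑ e, if 0 ∈ A.delaysVia s e then (S.w e : ℝ≥0∞) else 0

open Classical in
/-- `p_s(e)`: the probability of choosing `e` among the edges enabled (without delay) in `s`. -/
def p (S : StochasticTA A) (s : A.State) (e : A.E) : ℝ≥0∞ :=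
  if 0 ∈ A.delaysVia s e then S.w e / S.enabledWeight s else 0

lemma sum_p (S : StochasticTA A) (s : A.State) (h : ∃ e, 0 ∈ A.delaysVia s e) : ∑ e, S.p s e = 1 := by
  classical
  obtain ⟨e₀, h₀⟩ := h
  have h1 : S.enabledWeight s ≠ 0 := by
    intro h
    have := (Finset.sum_eq_zero_iff.1 h) e₀ (Finset.mem_univ _)
    simp [h₀, (S.w_pos e₀).ne'] at this
  have h2 : S.enabledWeight s ≠ ∞ := by
    refine (ENNReal.sum_lt_top.2 fun e _ => ?_).ne
    split_ifs <;> simp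
  have : ∀ e, S.p s e = (if 0 ∈ A.delaysVia s e then (S.w e : ℝ≥0∞) else 0) /
      S.enabledWeight s := by
    intro e; unfold p; split_ifs <;> simp
  simp only [this, div_eq_mul_inv, ← Finset.sum_mul]
  exact ENNReal.mul_inv_cancel h1 h2

lemma sum_p_le (S : StochasticTA A) (s : A.State) : ∑ e, S.p s e ≤ 1 := by
  by_cases h : ∃ e, 0 ∈ A.delaysVia s e
  · exact (S.sum_p s h).le
  · push Not at h
    simp [p, h]

lemma zero_mem_delaysVia_shift {s : A.State} {t : ℝ≥0} {e : A.E} (h : t ∈ A.delaysVia s e) :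
    0 ∈ A.delaysVia (A.shift s t) e := by
  have h' := TimedAutomaton.exists_trans_iff.1 h
  refine TimedAutomaton.exists_trans_iff.2 ?_
  have h0 : ∀ v : Valuation X, elapse v 0 = v := fun v => by ext; simp [elapse]
  rw [h0, TimedAutomaton.shift_loc, TimedAutomaton.shift_val, if_pos h'.2.1]
  exact h'

section Kernels

variable [Countable L] (S : StochasticTA A)

lemma measurableSet_enabled (e : A.E) : MeasurableSet {s : A.State | 0 ∈ A.delaysVia s e} :=
  (by fun_prop : Measurable fun s : A.State => (s, (0 : ℝ≥0)))
    (TimedAutomaton.measurableSet_exists_trans e)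

lemma measurable_enabledWeight : Measurable S.enabledWeight := by
  classical
  unfold enabledWeight
  exact Finset.measurable_sum _ fun e _ =>
    Measurable.ite (measurableSet_enabled e) measurable_const measurable_const

lemma measurable_p (e : A.E) : Measurable fun s => S.p s e := by
  classical
  exact Measurable.ite (measurableSet_enabled e)
    (measurable_const.div S.measurable_enabledWeight) measurable_const

/-- The choice of an edge `e` with probability `p_{s+t}(e)`, after the delay `t` from `s`. -/
def edgeKernel : Kernel (A.State × ℝ≥0) A.E where
  toFun q := ∑ e, S.p (A.shift q.1 q.2) e • Measure.dirac e
  measurable' := by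
    refine Measure.measurable_of_measurable_coe _ fun B _ => ?_
    simp only [Measure.coe_finsetSum, Finset.sum_apply, Measure.smul_apply, smul_eq_mul]
    exact Finset.measurable_sum _ fun e _ =>
      ((S.measurable_p e).comp TimedAutomaton.measurable_shift).mul_const _

lemma edgeKernel_univ (q : A.State × ℝ≥0) :
    S.edgeKernel q Set.univ = ∑ e, S.p (A.shift q.1 q.2) e := by
  simp [edgeKernel]

instance : IsFiniteKernel S.edgeKernel :=
  ⟨1, by simp, fun q => (S.edgeKernel_univ q).trans_le (S.sum_p_le _)⟩

/-- One step from a state `s`: the delay `t` is drawn from `μ_s`, then the edge `e` is drawn from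
`p_{s+t}`. -/
def stepKernel : Kernel A.State (ℝ≥0 × A.E) := S.μ ⊗ₖ S.edgeKernel

instance : IsMarkovKernel S.stepKernel := by
  refine ⟨fun s => ⟨?_⟩⟩
  rw [stepKernel, Kernel.compProd_apply MeasurableSet.univ]
  have h : ∀ᵐ t ∂S.μ s, t ∈ A.delays s := by
    refine (mem_ae_iff_prob_eq_one (MeasurableSet.iUnion fun e => ?_)).2 (S.μ_delays s)
    exact (by fun_prop : Measurable fun t : ℝ≥0 => (s, t))
      (TimedAutomaton.measurableSet_exists_trans e)
  rw [lintegral_congr_ae (g := fun _ => 1)]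
  · simp
  · filter_upwards [h] with t ht
    obtain ⟨e, he⟩ := Set.mem_iUnion.1 ht
    simpa [edgeKernel_univ] using S.sum_p _ ⟨e, zero_mem_delaysVia_shift he⟩

/-- The law of the configuration `(s, t, e)` from a state `s`. -/
def configKernel : Kernel A.State A.Config := Kernel.id ×ₖ S.stepKernel

instance : IsMarkovKernel S.configKernel := by unfold configKernel; infer_instance

/-- The law of the next configuration, given a configuration. -/
def nextKernel : Kernel A.Config A.Config :=
  S.configKernel.comap (fun q => A.next q.1 q.2.1 q.2.2) TimedAutomaton.measurable_next

instance : IsMarkovKernel S.nextKernel := by unfold nextKernel; infer_instance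

/-- The probability measure `ℙ_A` on infinite runs from `s`, as the law of the Markov chain of the
configurations `(sₙ, tₙ₊₁, eₙ₊₁)`; it is carried by `A.runs s`. -/
def prob (s : A.State) : Measure (ℕ → A.Config) :=
  Kernel.trajMeasure (X := fun _ => A.Config) (S.configKernel s) fun n =>
    S.nextKernel.comap (fun h : (i : Finset.Iic n) → A.Config => h ⟨n, Finset.mem_Iic.2 le_rfl⟩)
      (measurable_pi_apply _)


end Kernels

/-! ## Fairness, reactive and weak reactive automata -/

section Classes

variable [Fintype L]

/-- `A` is almost-surely fair from `s`. -/
def AlmostSurelyFair (S : StochasticTA A) (s : A.State) : Prop :=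
  S.prob s {ρ | ρ ∈ A.runs s ∧ A.IsFair ρ} = 1

/-- Reactive stochastic timed automata. -/
def IsReactive (S : StochasticTA A) : Prop :=
  A.IsReactive ∧ ∀ ℓ : L, ∃ m : Measure ℝ≥0, IsProbabilityMeasure m ∧ MeasEquiv m lebesgue ∧
    ∀ s : A.State, s.loc = ℓ → S.μ s = m

end Classes

end StochasticTA

/-- The set `L_u` of the locations `ℓ` such that `I(ℓ, v)` is unbounded for all `v ⊨ ℐ(ℓ)`. Its
complement is `L_b`. -/
def TimedAutomaton.unboundedLocs {L X : Type*} (A : TimedAutomaton L X) : Set L :=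
  {ℓ | ∀ s : A.State, s.loc = ℓ → ¬ BddAbove (A.delays s)}

namespace StochasticTA

variable {L X : Type*} {A : TimedAutomaton L X}

/-- Weak reactive stochastic timed automata. In the third condition the union is over the sequences
`e₁ … e_N` such that the target of `e_i` is in `L_u` for some `1 ≤ i < N`. -/
structure IsWeakReactive [Fintype L] (S : StochasticTA A) : Prop where
  μ_eq : ∀ s s' : A.State, s.loc = s'.loc →
    (∀ x, s.val x = s'.val x ∨ (A.maxConst : ℝ≥0) < min (s.val x) (s'.val x)) → S.μ s = S.μ s'
  unbounded : ∃ lam₀ : ℝ≥0, 0 < lam₀ ∧ lam₀ ≤ 1 ∧ ∀ s : A.State, s.loc ∈ A.unboundedLocs →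
    lam₀ ≤ S.μ s (Set.Ici (A.maxConst : ℝ≥0))
  bounded : ∃ lam₁ : ℝ≥0, 0 < lam₁ ∧ lam₁ ≤ 1 ∧ ∃ N : ℕ, 1 ≤ N ∧
    ∀ s : A.State, s.loc ∉ A.unboundedLocs →
      lam₁ ≤ S.prob s (⋃ es ∈ {es : Fin N → A.E | ∃ i : Fin N, (i : ℕ) + 1 < N ∧
        (es i).1.target ∈ A.unboundedLocs}, A.cyl s es)

end StochasticTA

end

end STA

/-! The configurations (state, delay, edge) form a homogeneous Markov chain. The engine is a
consequence of Lévy's zero-one law (`MarkovChain.ae_frequently_mem`): if infinitely often the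
conditional probability of visiting a set within `N` steps is at least a fixed `ε > 0`, the set is
almost surely visited infinitely often.

It is used three times. By condition 3, `L_u` is visited infinitely often. By condition 2, and since
the delay law of a state in `L_u` has no atom, delays greater than `M` occur infinitely often. After
such a delay every clock is zero or above `M`; with condition 1, the law of the future, as far as
regions are concerned, depends only on the location and on the set of zero clocks. These are
finitely many data, so along the run one class of such states recurs.

Fix a thick edge `f`. The probability of taking `f` within `N` steps is constant on that class
(`visitProb_edgeConfigs_congr`). If it is positive for some `N`, the engine applies a third time and
`f` is taken infinitely often. If it is zero for every `N`, it almost surely stays zero along the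
rest of the run (`ae_visitProb_next_eq_zero`); but then the source of `f` is never visited again,
since thickness gives `f` positive probability from each state of its source
(`μ_regionDelaysVia_ne_zero`). Thus no bound uniform over the source region is needed.

In a reactive automaton `L_b` is empty and the delay law depends only on the location, so `λ₀` is a
minimum over finitely many locations. -/

noncomputable section

/-! ### Recurrence for homogeneous Markov chains. -/

namespace MarkovChain

variable {Ω : Type*} [MeasurableSpace Ω] (μ₀ : Measure Ω) [IsProbabilityMeasure μ₀]
  (K : Kernel Ω Ω) [IsMarkovKernel K]

/-- The law of the time-homogeneous Markov chain with initial law `μ₀` and transition kernel `K`. -/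
def law : Measure (ℕ → Ω) :=
  Kernel.trajMeasure (X := fun _ => Ω) μ₀ fun n =>
    K.comap (fun h : (i : Finset.Iic n) → Ω => h ⟨n, Finset.mem_Iic.2 le_rfl⟩)
      (measurable_pi_apply _)

instance : IsProbabilityMeasure (law μ₀ K) := by unfold law; infer_instance

/-- The natural filtration of a sequence of `Ω`-valued variables. -/
abbrev natFiltration (Ω : Type*) [MeasurableSpace Ω] :
    Filtration ℕ (MeasurableSpace.pi : MeasurableSpace (ℕ → Ω)) :=
  Filtration.piLE (X := fun _ : ℕ => Ω)

lemma map_zero : (law μ₀ K).map (fun ρ => ρ 0) = μ₀ := by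
  unfold law Kernel.trajMeasure
  have h : (fun ρ : ℕ → Ω => ρ 0) =
      (fun h : (i : Finset.Iic 0) → Ω => h ⟨0, Finset.mem_Iic.2 le_rfl⟩) ∘
        Preorder.frestrictLe 0 := rfl
  rw [h, ← Measure.map_map (by fun_prop) (by fun_prop), Measure.map_comp _ _ (by fun_prop),
    Kernel.traj_map_frestrictLe, Kernel.partialTraj_self, Measure.id_comp,
    Measure.map_map (by fun_prop) (by fun_prop)]
  have h2 : (fun h : (i : Finset.Iic 0) → Ω => h ⟨0, Finset.mem_Iic.2 le_rfl⟩) ∘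
      (MeasurableEquiv.piUnique fun _ : Finset.Iic 0 => Ω).symm = id := by
    ext x
    simp [MeasurableEquiv.piUnique]
  exact (congrArg (fun g => μ₀.map g) h2).trans Measure.map_id

/-- The one-step Markov property at time `n`, in integrated form: an event of the natural filtration
is a condition `t` on the history up to `n`, and the disintegration of `trajMeasure` is tested on
`1_t` times `f`. -/
lemma lintegral_pair {n : ℕ} {B : Set (ℕ → Ω)} (hB : MeasurableSet[natFiltration Ω n] B)
    {f : Ω × Ω → ℝ≥0∞} (hf : Measurable f) :
    ∫⁻ ρ in B, f (ρ n, ρ (n + 1)) ∂law μ₀ K = ∫⁻ ρ in B, ∫⁻ c, f (ρ n, c) ∂K (ρ n) ∂law μ₀ K := by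
  rw [Filtration.piLE_eq_comap_frestrictLe] at hB
  obtain ⟨t, ht, rfl⟩ := hB
  have hm : MeasurableSet ((Preorder.frestrictLe n : (ℕ → Ω) → _) ⁻¹' t) :=
    (Preorder.measurable_frestrictLe n) ht
  have key := Kernel.map_frestrictLe_trajMeasure_compProd_eq_map_trajMeasure
    (X := fun _ => Ω) (μ₀ := μ₀) (κ := fun n =>
    K.comap (fun h : (i : Finset.Iic n) → Ω => h ⟨n, Finset.mem_Iic.2 le_rfl⟩)
      (measurable_pi_apply _)) (a := n)
  let g : ((i : Finset.Iic n) → Ω) × Ω → ℝ≥0∞ := fun q =>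
    t.indicator (fun _ => 1) q.1 * f (q.1 ⟨n, Finset.mem_Iic.2 le_rfl⟩, q.2)
  have hg : Measurable g :=
    ((measurable_one.indicator ht).comp measurable_fst).mul (by fun_prop)
  have h1 := congrArg (fun m => ∫⁻ q, g q ∂m) key
  rw [lintegral_map hg (by fun_prop), Measure.lintegral_compProd hg,
    lintegral_map (by fun_prop) (by fun_prop)] at h1
  rw [← lintegral_indicator hm, ← lintegral_indicator hm]
  refine Eq.trans ?_ (h1.symm.trans ?_)
  · refine lintegral_congr fun ρ => ?_
    by_cases h : Preorder.frestrictLe n ρ ∈ t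
    · simp [g, h]
    · simp [g, h]
  · refine lintegral_congr fun ρ => ?_
    by_cases h : Preorder.frestrictLe n ρ ∈ t
    · simp [g, h]
    · simp [g, h]

lemma measurable_eval {n k : ℕ} (h : n ≤ k) :
    Measurable[natFiltration Ω k] fun ρ : ℕ → Ω => ρ n := by
  rw [Filtration.piLE_eq_comap_frestrictLe]
  have : (fun ρ : ℕ → Ω => ρ n) = (fun g : (i : Finset.Iic k) → Ω => g ⟨n, Finset.mem_Iic.2 h⟩) ∘
      Preorder.frestrictLe k := rfl
  rw [this]
  exact (measurable_pi_apply _).comp (comap_measurable _)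

/-- By `lintegral_pair` the indicator of failure at time `n` has integral zero, and there are
countably many `n`. -/
lemma ae_pair {Q : Ω → Ω → Prop} (hQ : MeasurableSet {q : Ω × Ω | Q q.1 q.2})
    (h : ∀ c, ∀ᵐ c' ∂K c, Q c c') : ∀ᵐ ρ ∂law μ₀ K, ∀ n, Q (ρ n) (ρ (n + 1)) := by
  refine ae_all_iff.2 fun n => ?_
  have key := lintegral_pair μ₀ K (n := n) MeasurableSet.univ
    (f := {q : Ω × Ω | Q q.1 q.2}ᶜ.indicator fun _ => 1) (measurable_one.indicator hQ.compl)
  simp only [Measure.restrict_univ] at key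
  have h2 : ∀ c, ∫⁻ c', {q : Ω × Ω | Q q.1 q.2}ᶜ.indicator (fun _ => (1 : ℝ≥0∞)) (c, c') ∂K c = 0 := by
    intro c
    rw [lintegral_eq_zero_iff (by
      exact (measurable_one.indicator hQ.compl).comp measurable_prodMk_left)]
    filter_upwards [h c] with c' hc'
    simp [hc']
  simp only [h2, lintegral_zero] at key
  have hm : Measurable fun ρ : ℕ → Ω => ({q : Ω × Ω | Q q.1 q.2}ᶜ.indicator (fun _ => (1 : ℝ≥0∞)))
      (ρ n, ρ (n + 1)) :=
    (measurable_one.indicator hQ.compl).comp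
      ((measurable_pi_apply n).prodMk (measurable_pi_apply (n + 1)))
  rw [lintegral_eq_zero_iff hm] at key
  filter_upwards [key] with ρ hρ
  by_contra hn
  simp [hn] at hρ

lemma ae_forall {Q : Ω → Prop} (hQ : MeasurableSet {c | Q c}) (h0 : ∀ᵐ c ∂μ₀, Q c)
    (h : ∀ c, ∀ᵐ c' ∂K c, Q c') : ∀ᵐ ρ ∂law μ₀ K, ∀ n, Q (ρ n) := by
  rw [← map_zero μ₀ K] at h0
  filter_upwards [ae_of_ae_map (measurable_pi_apply 0).aemeasurable h0,
    ae_pair μ₀ K (Q := fun _ c => Q c) (measurable_snd hQ) h] with ρ h1 h2 n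
  cases n with
  | zero => exact h1
  | succ n => exact h2 n

open Classical in
/-- The probability that the chain started at `c` visits `S` at a time in `{0, …, N}`. -/
def hit (S : Set Ω) : ℕ → Ω → ℝ≥0∞
  | 0, c => if c ∈ S then 1 else 0
  | N + 1, c => if c ∈ S then 1 else ∫⁻ c', hit S N c' ∂K c

variable {S : Set Ω}

lemma measurable_hit (hS : MeasurableSet S) (N : ℕ) : Measurable (hit K S N) := by
  induction N with
  | zero => exact Measurable.ite hS measurable_const measurable_const
  | succ N ih => exact Measurable.ite hS measurable_const ih.lintegral_kernel

lemma hit_le_one (N : ℕ) (c : Ω) : hit K S N c ≤ 1 := by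
  induction N generalizing c with
  | zero => unfold hit; split_ifs <;> simp
  | succ N ih =>
    unfold hit
    split_ifs
    · rfl
    · exact (lintegral_mono ih).trans (by simp)

lemma lintegral_hit_le (N : ℕ) (c : Ω) : ∫⁻ c', hit K S N c' ∂K c ≤ hit K S (N + 1) c := by
  conv_rhs => unfold hit
  split_ifs
  · exact (lintegral_mono (hit_le_one K N)).trans (by simp)
  · rfl

/-- The sequences which visit `S` at a time in `{n, …, n + N}`. -/
def visits (S : Set Ω) (n N : ℕ) : Set (ℕ → Ω) := {ρ | ∃ k ≤ N, ρ (n + k) ∈ S}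

lemma measurableSet_visits (hS : MeasurableSet S) (n N : ℕ) : MeasurableSet (visits S n N) := by
  have : visits S n N = ⋃ k ∈ Set.Iic N, (fun ρ : ℕ → Ω => ρ (n + k)) ⁻¹' S := by
    ext; simp [visits]
  rw [this]
  exact MeasurableSet.biUnion (Set.to_countable _) fun k _ => measurable_pi_apply _ hS

/-- This says that `hit K S N (ρ n)` is the conditional probability of a visit in `{n, …, n + N}`
given the past. Induction on `N`: split `B` according to whether `ρ n ∈ S`. Off `S` the visit must
occur from time `n + 1` on, so the induction hypothesis applies there, and `lintegral_pair` brings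
the integral back to time `n`. -/
lemma law_inter_visits (hS : MeasurableSet S) (N n : ℕ) {B : Set (ℕ → Ω)}
    (hB : MeasurableSet[natFiltration Ω n] B) :
    law μ₀ K (B ∩ visits S n N) = ∫⁻ ρ in B, hit K S N (ρ n) ∂law μ₀ K := by
  classical
  have hSn : MeasurableSet[natFiltration Ω n] ((fun ρ : ℕ → Ω => ρ n) ⁻¹' S) :=
    measurable_eval le_rfl hS
  have hle := (natFiltration Ω).le n
  induction N generalizing n B with
  | zero =>
    have h1 : B ∩ visits S n 0 = B ∩ (fun ρ : ℕ → Ω => ρ n) ⁻¹' S := by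
      ext; simp [visits]
    have h2 : (fun ρ : ℕ → Ω => hit K S 0 (ρ n)) =
        ((fun ρ : ℕ → Ω => ρ n) ⁻¹' S).indicator fun _ => 1 := by
      ext ρ; simp [hit, Set.indicator]
    rw [h1, h2, setLIntegral_indicator (hle _ hSn)]
    simp [Set.inter_comm]
  | succ N ih =>
    set D := (fun ρ : ℕ → Ω => ρ n) ⁻¹' S with hD
    have hBD := hB.inter hSn
    have hBD' := hB.diff hSn
    rw [← measure_inter_add_sdiff (B ∩ visits S n (N + 1)) (hle _ hSn),
      ← lintegral_inter_add_sdiff _ B (hle _ hSn)]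
    congr 1
    · have h1 : B ∩ visits S n (N + 1) ∩ D = B ∩ D := by
        ext ρ
        simp only [Set.mem_inter_iff, visits, hD, Set.mem_preimage]
        exact ⟨fun h => ⟨h.1.1, h.2⟩, fun h => ⟨⟨h.1, 0, by omega, h.2⟩, h.2⟩⟩
      rw [h1, setLIntegral_congr_fun (g := fun _ => 1) (hle _ hBD)]
      · simp
      · intro ρ hρ
        have : ρ n ∈ S := hρ.2
        simp [hit, this]
    · have h1 : (B ∩ visits S n (N + 1)) \ D = (B \ D) ∩ visits S (n + 1) N := by
        ext ρ
        simp only [visits, hD, Set.mem_inter_iff, Set.mem_sdiff, Set.mem_preimage, Set.mem_ofPred_eq]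
        constructor
        · rintro ⟨⟨h1, k, hk, h2⟩, h3⟩
          cases k with
          | zero => exact absurd h2 h3
          | succ k => exact ⟨⟨h1, h3⟩, k, by omega, by rwa [show n + 1 + k = n + (k + 1) by ring]⟩
        · rintro ⟨⟨h1, h3⟩, k, hk, h2⟩
          exact ⟨⟨h1, k + 1, by omega, by rwa [show n + 1 + k = n + (k + 1) by ring] at h2⟩, h3⟩
      rw [h1, ih (n + 1) ((natFiltration Ω).mono n.le_succ _ hBD') (measurable_eval le_rfl hS)
        ((natFiltration Ω).le _),
        lintegral_pair μ₀ K hBD' (f := fun q => hit K S N q.2)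
          ((measurable_hit K hS N).comp measurable_snd)]
      refine setLIntegral_congr_fun (hle _ hBD') fun ρ hρ => ?_
      have : ρ n ∉ S := hρ.2
      simp [hit, this]

lemma law_visits (hS : MeasurableSet S) (N : ℕ) :
    law μ₀ K (visits S 0 N) = ∫⁻ c, hit K S N c ∂μ₀ := by
  have := law_inter_visits μ₀ K hS N 0 MeasurableSet.univ
  simp only [Set.univ_inter, Measure.restrict_univ] at this
  rw [this, ← lintegral_map (f := hit K S N) (measurable_hit K hS N) (measurable_pi_apply 0), map_zero]

lemma iSup_natFiltration : ⨆ n, (natFiltration Ω) n = MeasurableSpace.pi := by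
  refine le_antisymm (iSup_le (natFiltration Ω).le) ?_
  refine iSup_le fun n => ?_
  exact le_trans (measurable_iff_comap_le.1 (measurable_eval le_rfl)) (le_iSup _ n)

/-- If infinitely often the conditional probability of visiting `S` in the next `N` steps is at
least `ε`, then `S` is visited infinitely often, almost surely. -/
theorem ae_frequently_mem (hS : MeasurableSet S) (N : ℕ) {ε : ℝ≥0∞} (hε : 0 < ε) :
    ∀ᵐ ρ ∂law μ₀ K, (∃ᶠ n in atTop, ε ≤ hit K S N (ρ n)) → ∃ᶠ n in atTop, ρ n ∈ S := by
  set P := law μ₀ K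
  -- Lévy's upward theorem is applied to these events: the conditional probability of `V m` given
  -- the past up to `n` tends to the indicator of `V m`, hence to `0` on a sequence that avoids `S`
  -- from time `m` on. For `n ≥ m` it dominates `hit K S N (ρ n)`.
  let V : ℕ → Set (ℕ → Ω) := fun m => {ρ | ∃ k, m ≤ k ∧ ρ k ∈ S}
  have hV : ∀ m, MeasurableSet (V m) := by
    intro m
    have : V m = ⋃ k ∈ Set.Ici m, (fun ρ : ℕ → Ω => ρ k) ⁻¹' S := by
      ext; simp [V]
    rw [this]
    exact MeasurableSet.biUnion (Set.to_countable _) fun k _ => measurable_pi_apply _ hS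
  have h1 : ∀ m, ∀ᵐ ρ ∂P, Tendsto (fun n => (P[(V m).indicator (fun _ => (1 : ℝ)) | natFiltration Ω n]) ρ)
      atTop (nhds ((V m).indicator (fun _ => (1 : ℝ)) ρ)) := by
    intro m
    refine Integrable.tendsto_ae_condExp ((integrable_const 1).indicator (hV m)) ?_
    rw [iSup_natFiltration]
    exact (stronglyMeasurable_const).indicator (hV m)
  have h2 : ∀ n, (fun ρ => (hit K S N (ρ n)).toReal) =ᵐ[P]
      P[(visits S n N).indicator (fun _ => (1 : ℝ)) | natFiltration Ω n] := by
    intro n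
    have hmeas : Measurable[natFiltration Ω n] fun ρ : ℕ → Ω => (hit K S N (ρ n)).toReal :=
      ((measurable_hit K hS N).comp (measurable_eval le_rfl)).ennreal_toReal
    have hmeas' := hmeas.mono ((natFiltration Ω).le n) le_rfl
    have hint : Integrable (fun ρ : ℕ → Ω => (hit K S N (ρ n)).toReal) P := by
      refine Integrable.of_bound hmeas'.aestronglyMeasurable 1 (ae_of_all _ fun ρ => ?_)
      rw [Real.norm_eq_abs, abs_of_nonneg ENNReal.toReal_nonneg]
      exact ENNReal.toReal_le_of_le_ofReal zero_le_one (by simpa using hit_le_one K N _)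
    refine ae_eq_condExp_of_forall_setIntegral_eq ((natFiltration Ω).le n)
      ((integrable_const 1).indicator (measurableSet_visits hS n N)) (fun s _ _ => hint.integrableOn)
      (fun B hB _ => ?_) hmeas.stronglyMeasurable.aestronglyMeasurable
    have hm : Measurable fun ρ : ℕ → Ω => hit K S N (ρ n) :=
      (measurable_hit K hS N).comp (measurable_pi_apply n)
    rw [integral_toReal hm.aemeasurable
      (ae_of_all _ fun ρ => (hit_le_one K N _).trans_lt ENNReal.one_lt_top)]
    have hb := law_inter_visits μ₀ K hS N n hB
    rw [← hb, setIntegral_indicator (measurableSet_visits hS n N)]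
    simp [Measure.real, P]
  have h3 : ∀ m n, m ≤ n → ∀ᵐ ρ ∂P, (hit K S N (ρ n)).toReal ≤
      (P[(V m).indicator (fun _ => (1 : ℝ)) | natFiltration Ω n]) ρ := by
    intro m n hmn
    have hle : (visits S n N).indicator (fun _ => (1 : ℝ)) ≤ᵐ[P] (V m).indicator (fun _ => (1 : ℝ)) := by
      refine ae_of_all _ fun ρ => Set.indicator_le_indicator_of_subset ?_ (fun _ => zero_le_one) ρ
      rintro ρ ⟨k, _, hk⟩
      exact ⟨n + k, by omega, hk⟩
    filter_upwards [h2 n, condExp_mono (m := natFiltration Ω n)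
      ((integrable_const (1 : ℝ)).indicator (measurableSet_visits hS n N))
      ((integrable_const (1 : ℝ)).indicator (hV m)) hle] with ρ ha hb
    rw [ha]; exact hb
  have h3' : ∀ᵐ ρ ∂P, ∀ m n, m ≤ n → (hit K S N (ρ n)).toReal ≤
      (P[(V m).indicator (fun _ => (1 : ℝ)) | natFiltration Ω n]) ρ :=
    ae_all_iff.2 fun m => ae_all_iff.2 fun n => by
      by_cases h : m ≤ n
      · simpa [h] using h3 m n h
      · simp [h]
  filter_upwards [ae_all_iff.2 h1, h3'] with ρ ha hb hfreq
  refine frequently_atTop.2 fun m => ?_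
  by_contra hno
  have hρ : ρ ∉ V m := fun ⟨k, hk⟩ => hno ⟨k, hk.1, hk.2⟩
  have hlim := ha m
  rw [Set.indicator_of_notMem hρ] at hlim
  -- The truncation covers `ε = ∞`, whose `toReal` is `0`; it loses nothing because `hit` is at most
  -- `1`.
  have hε' : 0 < (min ε 1).toReal := 
    ENNReal.toReal_pos (lt_min hε one_pos).ne' ((min_le_right ε 1).trans_lt ENNReal.one_lt_top).ne
  have hev := (hlim.eventually (gt_mem_nhds hε')).and (eventually_ge_atTop m)
  obtain ⟨n, hn1, hn2, hn3⟩ := (hfreq.and_eventually hev).exists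
  have := hb m n hn3
  have h5 : (min ε 1).toReal ≤ (hit K S N (ρ n)).toReal :=
    ENNReal.toReal_mono ((hit_le_one K N _).trans_lt ENNReal.one_lt_top).ne ((min_le_left _ _).trans hn1)
  linarith

end MarkovChain

end

noncomputable section

/-! ### Region equivalence as a time-abstract bisimulation. -/

namespace STA

/-- All five comparisons reduce to `a ≤ c` and `a < c`. Both fail above `M`; otherwise the integer
part, and whether the fractional part vanishes, decide them. -/
lemma Cmp.holds_congr {M c : ℕ} (hc : c ≤ M) {a b : ℝ≥0}
    (h : ((M : ℝ≥0) < a ∧ (M : ℝ≥0) < b) ∨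
      (⌊a⌋₊ = ⌊b⌋₊ ∧ (Int.fract (a : ℝ) = 0 ↔ Int.fract (b : ℝ) = 0))) (cmp : Cmp) :
    cmp.Holds a c ↔ cmp.Holds b c := by
  have hc' : (c : ℝ≥0) ≤ M := by exact_mod_cast hc
  obtain ⟨h1, h2⟩ : (a ≤ c ↔ b ≤ c) ∧ (a < c ↔ b < c) := by
    rcases h with ⟨ha, hb⟩ | ⟨h1, h2⟩
    · have ha' := hc'.trans_lt ha
      have hb' := hc'.trans_lt hb
      exact ⟨iff_of_false (not_le.2 ha') (not_le.2 hb'), iff_of_false ha'.not_gt hb'.not_gt⟩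
    · refine ⟨TimedAutomaton.le_iff_of_floor_eq h1 h2, ?_⟩
      rw [← Nat.floor_lt (zero_le (a := a)), ← Nat.floor_lt (zero_le (a := b)), h1]
  cases cmp
  · exact h2
  · exact h1
  · have h3 := not_congr h2
    rw [not_lt, not_lt] at h3
    simp only [Cmp.Holds, le_antisymm_iff, h1, h3]
  · simp only [Cmp.Holds, ← not_lt, h2]
  · simp only [Cmp.Holds, ← not_le, h1]

lemma le_guardMax {X : Type*} {g : Guard X} {a : AtomicConstraint X} (ha : a ∈ g) :
    a.const ≤ guardMax g := by
  unfold guardMax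
  induction g with
  | nil => simp at ha
  | cons b g ih =>
    simp only [List.map_cons, List.foldr_cons, le_max_iff]
    rcases List.mem_cons.1 ha with rfl | h
    · exact Or.inl le_rfl
    · exact Or.inr (ih h)

lemma natCast_nnreal_floor (a : ℝ≥0) : ((⌊a⌋₊ : ℕ) : ℤ) = ⌊(a : ℝ)⌋ := by
  refine (Int.floor_eq_iff.2 ⟨?_, ?_⟩).symm
  · exact_mod_cast Nat.floor_le (zero_le (a := a))
  · exact_mod_cast Nat.lt_floor_add_one a

lemma nnreal_floor_eq_iff {a b : ℝ≥0} : ⌊a⌋₊ = ⌊b⌋₊ ↔ ⌊(a : ℝ)⌋ = ⌊(b : ℝ)⌋ := by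
  rw [← natCast_nnreal_floor, ← natCast_nnreal_floor, Nat.cast_inj]

lemma floor_add_of_fract_lt {a t : ℝ} (h : Int.fract a < 1 - Int.fract t) :
    ⌊a + t⌋ = ⌊a⌋ + ⌊t⌋ := by
  rw [Int.floor_eq_iff]
  have ha := Int.floor_add_fract a
  have ht := Int.floor_add_fract t
  have h1 := Int.fract_nonneg a
  have h2 := Int.fract_nonneg t
  push_cast
  constructor <;> linarith

lemma floor_add_of_le_fract {a t : ℝ} (h : 1 - Int.fract t ≤ Int.fract a) :
    ⌊a + t⌋ = ⌊a⌋ + ⌊t⌋ + 1 := by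
  rw [Int.floor_eq_iff]
  have ha := Int.floor_add_fract a
  have ht := Int.floor_add_fract t
  have h1 := Int.fract_lt_one a
  have h2 := Int.fract_lt_one t
  push_cast
  constructor <;> linarith

/-- A cut `σ` of `(0, 1]` can be transported between two order-equivalent families of points of
`[0, 1)`. -/
lemma exists_cut {ι : Type*} [Finite ι] (p : ι → Prop) {f g : ι → ℝ}
    (hg : ∀ i, 0 ≤ g i ∧ g i < 1)
    (hfg : ∀ i j, p i → p j → (f i ≤ f j ↔ g i ≤ g j)) (h0 : ∀ i, p i → (f i = 0 ↔ g i = 0))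
    (hf : ∀ i, 0 ≤ f i ∧ f i < 1) {σ : ℝ} (hσ0 : 0 < σ) (hσ1 : σ ≤ 1) :
    ∃ σ', 0 < σ' ∧ σ' ≤ 1 ∧ (σ = 1 ↔ σ' = 1) ∧
      ∀ i, p i → ((f i < σ ↔ g i < σ') ∧ (σ < f i ↔ σ' < g i)) := by
  classical
  have := Fintype.ofFinite ι
  by_cases h1 : σ = 1
  · refine ⟨1, one_pos, le_rfl, by simp [h1], fun i _ => ?_⟩
    subst h1
    simp [hf, hg, (hf i).2.not_gt, (hg i).2.not_gt]
  by_cases hex : ∃ i, p i ∧ f i = σ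
  · obtain ⟨i, hi, rfl⟩ := hex
    refine ⟨g i, lt_of_le_of_ne (hg i).1 fun h => hσ0.ne' ((h0 i hi).2 h.symm), (hg i).2.le, ?_, ?_⟩
    · simp [h1, (hg i).2.ne]
    · intro j hj
      rw [← not_le, ← not_le, ← not_le, ← not_le, hfg i j hi hj, hfg j i hj hi]
      exact ⟨Iff.rfl, Iff.rfl⟩
  -- The cut avoids all the relevant `f i`: any point between the images of the lower and upper
  -- indices works, and the inserted `0` and `1` keep it inside `(0, 1)`.
  · obtain ⟨m, hm1, hm2⟩ := Order.exists_between_finsets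
      (insert 0 ((Finset.univ.filter fun i => p i ∧ f i < σ).image g))
      (insert 1 ((Finset.univ.filter fun i => p i ∧ σ < f i).image g)) (by
        simp only [Finset.mem_insert, Finset.mem_image, Finset.mem_filter, Finset.mem_univ,
          true_and]
        rintro x (rfl | ⟨i, ⟨hi, hi'⟩, rfl⟩) y (rfl | ⟨j, ⟨hj, hj'⟩, rfl⟩)
        · exact one_pos
        · refine lt_of_le_of_ne (hg j).1 fun h => ?_
          exact (hσ0.trans hj').ne' ((h0 j hj).2 h.symm)
        · exact (hg i).2
        · rw [← not_le, ← hfg j i hj hi, not_le]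
          exact hi'.trans hj')
    have hm0 : 0 < m := hm1 _ (Finset.mem_insert_self _ _)
    have hm1' : m < 1 := hm2 _ (Finset.mem_insert_self _ _)
    refine ⟨m, hm0, hm1'.le, by simp [h1, hm1'.ne], fun i hi => ?_⟩
    rcases lt_trichotomy (f i) σ with h | h | h
    · have := hm1 (g i) (by simp only [Finset.mem_insert, Finset.mem_image, Finset.mem_filter,
        Finset.mem_univ, true_and]; exact Or.inr ⟨i, ⟨hi, h⟩, rfl⟩)
      simp [h, this, h.not_gt, this.not_gt]
    · exact absurd ⟨i, hi, h⟩ hex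
    · have := hm2 (g i) (by simp only [Finset.mem_insert, Finset.mem_image, Finset.mem_filter,
        Finset.mem_univ, true_and]; exact Or.inr ⟨i, ⟨hi, h⟩, rfl⟩)
      simp [h, this, h.not_gt, this.not_gt]

namespace TimedAutomaton

variable {L X : Type*} [Fintype L] {A : TimedAutomaton L X}

lemma const_le_of_mem_guard (e : A.E) {a : AtomicConstraint X} (ha : a ∈ e.1.guard) :
    a.const ≤ A.maxConst :=
  ((le_guardMax ha).trans (Finset.le_sup (f := fun e : Edge L X => guardMax e.guard) e.2)).trans
    (le_max_left _ _)

lemma const_le_of_mem_inv (ℓ : L) {a : AtomicConstraint X} (ha : a ∈ A.inv ℓ) :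
    a.const ≤ A.maxConst :=
  ((le_guardMax ha).trans
    (Finset.le_sup (f := fun ℓ : L => guardMax (A.inv ℓ)) (Finset.mem_univ ℓ))).trans
    (le_max_right _ _)

lemma RegionEquiv.sat_iff {v v' : Valuation X} (h : A.RegionEquiv v v') {g : Guard X}
    (hg : ∀ a ∈ g, a.const ≤ A.maxConst) : Sat v g ↔ Sat v' g :=
  forall₂_congr fun a ha => Cmp.holds_congr (hg a ha) (h.1 a.clock) a.cmp

lemma RegionEquiv.reset {v v' : Valuation X} (h : A.RegionEquiv v v') (Y : Set X) :
    A.RegionEquiv (STA.reset Y v) (STA.reset Y v') := by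
  refine ⟨fun x => ?_, fun x y => ?_⟩
  · by_cases hx : x ∈ Y
    · simp [STA.reset, hx]
    · simpa [STA.reset, hx] using h.1 x
  · by_cases hx : x ∈ Y <;> by_cases hy : y ∈ Y
    · simp [STA.reset, hx, hy]
    · simp [STA.reset, hx, hy]
    · simp only [STA.reset, hx, hy, if_true, if_false]
      intro h1 _
      rcases h.1 x with h2 | h2
      · exact absurd h1 (not_le.2 h2.1)
      · simpa [le_antisymm_iff, Int.fract_nonneg] using h2.2
    · simpa [STA.reset, hx, hy] using h.2 x y

/-- Region equivalence is a time-abstract bisimulation. -/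
lemma RegionEquiv.exists_elapse [Finite X] {v v' : Valuation X} (h : A.RegionEquiv v v')
    (t : ℝ≥0) : ∃ t', A.RegionEquiv (elapse v t) (elapse v' t') := by
  have hp : ∀ x, v x ≤ A.maxConst → ⌊(v x : ℝ)⌋ = ⌊(v' x : ℝ)⌋ ∧
      (Int.fract (v x : ℝ) = 0 ↔ Int.fract (v' x : ℝ) = 0) := by
    intro x hx
    rcases h.1 x with h1 | ⟨h1, h2⟩
    · exact absurd hx (not_le.2 h1.1)
    · exact ⟨nnreal_floor_eq_iff.1 h1, h2⟩
  have hfr : ∀ w : Valuation X, ∀ x, 0 ≤ Int.fract (w x : ℝ) ∧ Int.fract (w x : ℝ) < 1 :=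
    fun w x => ⟨Int.fract_nonneg _, Int.fract_lt_one _⟩
  -- A clock passes one more integer exactly when its fractional part is at least `1 - fract t`.
  -- This threshold is transported to `v'`, and `t'` is the delay with the same integer part as `t`
  -- and threshold `σ'`.
  obtain ⟨σ', h0, h1, hiff, hcut⟩ := exists_cut (fun x => v x ≤ A.maxConst) (hfr v')
    (fun x y hx hy => h.2 x y hx hy) (fun x hx => (hp x hx).2) (hfr v)
    (σ := 1 - Int.fract (t : ℝ)) (by linarith [Int.fract_lt_one (t : ℝ)])
    (by linarith [Int.fract_nonneg (t : ℝ)])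
  let t' : ℝ≥0 := ⌊t⌋₊ + ⟨1 - σ', by linarith⟩
  have ht'c : (t' : ℝ) = (⌊t⌋₊ : ℕ) + (1 - σ') := rfl
  have ht'f : Int.fract (t' : ℝ) = 1 - σ' := by
    rw [ht'c, Int.fract_natCast_add, Int.fract_eq_self.2 ⟨by linarith, by linarith⟩]
  have ht'fl : ⌊(t' : ℝ)⌋ = ⌊(t : ℝ)⌋ := by
    rw [ht'c, Int.floor_natCast_add, Int.floor_eq_zero_iff.2 ⟨by linarith, by linarith⟩, add_zero,
      natCast_nnreal_floor]
  -- For each clock, either neither of its two values wraps around or both do.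
  have main : ∀ x, v x ≤ A.maxConst →
      (Int.fract (v x : ℝ) < 1 - Int.fract (t : ℝ) ∧ Int.fract (v' x : ℝ) < 1 - Int.fract (t' : ℝ) ∧
        Int.fract ((v x : ℝ) + t) = Int.fract (v x : ℝ) + Int.fract (t : ℝ) ∧
        Int.fract ((v' x : ℝ) + t') = Int.fract (v' x : ℝ) + Int.fract (t' : ℝ) ∧
        ⌊(v x : ℝ) + t⌋ = ⌊(v' x : ℝ) + t'⌋) ∨
      (1 - Int.fract (t : ℝ) ≤ Int.fract (v x : ℝ) ∧ 1 - Int.fract (t' : ℝ) ≤ Int.fract (v' x : ℝ) ∧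
        Int.fract ((v x : ℝ) + t) = Int.fract (v x : ℝ) + Int.fract (t : ℝ) - 1 ∧
        Int.fract ((v' x : ℝ) + t') = Int.fract (v' x : ℝ) + Int.fract (t' : ℝ) - 1 ∧
        ⌊(v x : ℝ) + t⌋ = ⌊(v' x : ℝ) + t'⌋) := by
    intro x hx
    have hc := (hcut x hx).1
    by_cases hlt : Int.fract (v x : ℝ) < 1 - Int.fract (t : ℝ)
    · have hlt' : Int.fract (v' x : ℝ) < 1 - Int.fract (t' : ℝ) := by
        rw [ht'f]; linarith [hc.1 hlt]
      refine Or.inl ⟨hlt, hlt', ?_, ?_, ?_⟩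
      · simp only [Int.fract, floor_add_of_fract_lt hlt]; push_cast; ring
      · simp only [Int.fract, floor_add_of_fract_lt hlt']; push_cast; ring
      · rw [floor_add_of_fract_lt hlt, floor_add_of_fract_lt hlt', ht'fl, (hp x hx).1]
    · have hlt' : 1 - Int.fract (t' : ℝ) ≤ Int.fract (v' x : ℝ) := by
        rw [ht'f]; linarith [not_lt.1 (fun h => hlt (hc.2 h))]
      rw [not_lt] at hlt
      refine Or.inr ⟨hlt, hlt', ?_, ?_, ?_⟩
      · simp only [Int.fract, floor_add_of_le_fract hlt]; push_cast; ring
      · simp only [Int.fract, floor_add_of_le_fract hlt']; push_cast; ring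
      · rw [floor_add_of_le_fract hlt, floor_add_of_le_fract hlt', ht'fl, (hp x hx).1]
  refine ⟨t', fun x => ?_, fun x y hx hy => ?_⟩
  · by_cases hx : v x ≤ A.maxConst
    · refine Or.inr ?_
      simp only [elapse, nnreal_floor_eq_iff, NNReal.coe_add]
      have hτ : Int.fract (t : ℝ) = 0 ↔ Int.fract (t' : ℝ) = 0 := by
        rw [ht'f]; constructor
        · intro h; linarith [hiff.1 (by linarith)]
        · intro h; linarith [hiff.2 (by linarith)]
      have a1 := Int.fract_nonneg (v x : ℝ)
      have a2 := Int.fract_nonneg (v' x : ℝ)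
      have a3 := Int.fract_nonneg (t : ℝ)
      have a4 := Int.fract_nonneg (t' : ℝ)
      rcases main x hx with ⟨_, _, h3, h4, h5⟩ | ⟨h1, h2, h3, h4, h5⟩
      · refine ⟨h5, ?_⟩
        rw [h3, h4, add_eq_zero_iff_of_nonneg a1 a3, add_eq_zero_iff_of_nonneg a2 a4, hτ,
          (hp x hx).2]
      · refine ⟨h5, ?_⟩
        rw [h3, h4]
        -- A wrapped fractional part is its excess over the cut, so it vanishes iff the original
        -- value is not strictly above the cut.
        have hc := (hcut x hx).2
        constructor
        · intro h6
          refine le_antisymm ?_ (by linarith)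
          by_contra h7
          have := hc.2 (by linarith)
          linarith
        · intro h6
          refine le_antisymm ?_ (by linarith)
          by_contra h7
          have := hc.1 (by linarith)
          linarith
    · refine Or.inl ⟨(not_le.1 hx).trans_le (by simp [elapse]), ?_⟩
      exact (not_le.1 fun h2 => hx ((h.le_iff x).2 h2)).trans_le (by simp [elapse])
  · have hx' : v x ≤ A.maxConst := le_trans (by simp [elapse]) hx
    have hy' : v y ≤ A.maxConst := le_trans (by simp [elapse]) hy
    have hxy := h.2 x y hx' hy'
    simp only [elapse, NNReal.coe_add]
    have b1 := Int.fract_lt_one (v x : ℝ)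
    have b2 := Int.fract_lt_one (v' x : ℝ)
    have b3 := Int.fract_lt_one (v y : ℝ)
    have b4 := Int.fract_lt_one (v' y : ℝ)
    have a1 := Int.fract_nonneg (v x : ℝ)
    have a2 := Int.fract_nonneg (v' x : ℝ)
    have a3 := Int.fract_nonneg (v y : ℝ)
    have a4 := Int.fract_nonneg (v' y : ℝ)
    -- Clocks with the same wrapping status keep their order; a wrapped fractional part lies
    -- strictly below an unwrapped one.
    rcases main x hx' with ⟨c1, c2, c3, c4, -⟩ | ⟨c1, c2, c3, c4, -⟩ <;>
    rcases main y hy' with ⟨d1, d2, d3, d4, -⟩ | ⟨d1, d2, d3, d4, -⟩ <;>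
    rw [c3, c4, d3, d4]
    · simpa using hxy
    · exact ⟨fun h => by linarith, fun h => by linarith⟩
    · exact ⟨fun _ => by linarith, fun _ => by linarith⟩
    · simpa using hxy

lemma exists_trans_of_regionEquiv {s s' : A.State} {t t' : ℝ≥0} {e : A.E} (hloc : s.loc = s'.loc)
    (h : A.RegionEquiv (elapse s.val t) (elapse s'.val t')) (ht : ∃ u, A.Trans s t e u) :
    ∃ u, A.Trans s' t' e u := by
  rw [exists_trans_iff] at ht ⊢
  obtain ⟨h1, h2, h3, h4⟩ := ht
  exact ⟨h1.trans hloc, hloc ▸ (h.sat_iff fun _ => const_le_of_mem_inv _).1 h2,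
    (h.sat_iff fun _ => const_le_of_mem_guard e).1 h3,
    ((h.reset _).sat_iff fun _ => const_le_of_mem_inv _).1 h4⟩

/-- The time-abstract bisimulation property of region equivalence, for the edges of the timed
region automaton. -/
lemma regionDelaysVia_nonempty [Finite X] {s : A.State} {f : A.RegionEdge}
    (hs : f.source = A.regionState s) : (A.regionDelaysVia s f).Nonempty := by
  obtain ⟨s₀, t₀, u₀, h₀, h1, h2, h3⟩ := f.exists_trans
  have h4 := h1.trans hs
  simp only [regionState, Prod.mk.injEq] at h4
  have h5 : A.RegionEquiv s₀.val s.val := Quotient.exact h4.2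
  obtain ⟨t, ht⟩ := h5.exists_elapse t₀
  obtain ⟨u, hu⟩ := exists_trans_of_regionEquiv h4.1 ht ⟨u₀, h₀⟩
  refine ⟨t, u, hu, rfl, hs, h2.symm.trans (Quotient.sound ht), h3.symm.trans ?_⟩
  simp only [regionState, Prod.mk.injEq]
  refine ⟨h₀.2.2.2.1.trans hu.2.2.2.1.symm, ?_⟩
  rw [h₀.2.2.2.2, hu.2.2.2.2]
  exact Quotient.sound (ht.reset _)

/-- Countability suffices: it serves to treat all region edges outside a single null set. -/
instance [Finite X] : Countable A.Region := by
  classical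
  let F : A.Region → (X → Option (ℕ × Prop)) × (X → X → Prop) := fun r =>
    (fun x => if (A.maxConst : ℝ≥0) < r.out x then none
      else some (⌊r.out x⌋₊, Int.fract (r.out x : ℝ) = 0),
    fun x y => Int.fract (r.out x : ℝ) ≤ Int.fract (r.out y : ℝ))
  refine Function.Injective.countable (f := F) fun r r' h => ?_
  rw [← Quotient.out_eq r, ← Quotient.out_eq r']
  refine Quotient.sound ⟨fun x => ?_, fun x y _ _ => ?_⟩
  · have h1 := congrFun (congrArg Prod.fst h) x
    simp only [F] at h1
    split_ifs at h1 with h2 h3 h3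
    · exact Or.inl ⟨h2, h3⟩
    · simp only [Option.some.injEq, Prod.mk.injEq, eq_iff_iff] at h1
      exact Or.inr h1
  · have h1 := congrFun (congrFun (congrArg Prod.snd h) x) y
    exact iff_of_eq h1

instance [Finite X] : Countable A.RegionEdge := by
  refine Function.Injective.countable
    (f := fun f : A.RegionEdge => (f.source, f.mid, f.edge, f.target)) fun f g h => ?_
  simp only [Prod.mk.injEq] at h
  exact RegionEdge.ext h.1 h.2.1 h.2.2.1 h.2.2.2

lemma measurableSet_region_eq [Finite X] {Ω : Type*} [MeasurableSpace Ω] {g : Ω → Valuation X}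
    (hg : ∀ x, Measurable fun ω => g ω x) (r : A.Region) :
    MeasurableSet {ω | A.region (g ω) = r} := by
  obtain ⟨v, rfl⟩ := Quotient.exists_rep r
  have h : ∀ ω, A.region (g ω) = Quotient.mk _ v ↔ A.RegionEquiv (g ω) v := fun ω => Quotient.eq
  simp only [h, RegionEquiv]
  have hfr : ∀ x, Measurable fun ω => Int.fract (g ω x : ℝ) := fun x =>
    measurable_fract.comp (measurable_coe_nnreal_real.comp (hg x))
  have h1 : ∀ x, MeasurableSet {ω | (A.maxConst : ℝ≥0) < g ω x} := fun x =>
    measurableSet_lt measurable_const (hg x)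
  have h2 : ∀ x, MeasurableSet {ω | g ω x ≤ (A.maxConst : ℝ≥0)} := fun x =>
    measurableSet_le (hg x) measurable_const
  have h3 : ∀ x, MeasurableSet {ω | Int.fract (g ω x : ℝ) = 0} := fun x =>
    measurableSet_eq_fun (hfr x) measurable_const
  have h4 : ∀ x y, MeasurableSet {ω | Int.fract (g ω x : ℝ) ≤ Int.fract (g ω y : ℝ)} := fun x y =>
    measurableSet_le (hfr x) (hfr y)
  have h5 : ∀ x, MeasurableSet {ω | ⌊g ω x⌋₊ = ⌊v x⌋₊} := fun x =>
    measurableSet_eq_fun (Nat.measurable_floor.comp (hg x)) measurable_const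
  refine measurableSet_setOfPred.2 (.and (.forall fun x => ?_) (.forall fun x => .forall fun y => ?_))
  · exact .or (.and (measurableSet_setOfPred.1 (h1 x)) measurable_const)
      (.and (measurableSet_setOfPred.1 (h5 x)) (.iff (measurableSet_setOfPred.1 (h3 x)) measurable_const))
  · exact .imp (measurableSet_setOfPred.1 (h2 x)) (.imp (measurableSet_setOfPred.1 (h2 y))
      (.iff (measurableSet_setOfPred.1 (h4 x y)) measurable_const))

end TimedAutomaton

end STA

end

noncomputable section

namespace STA

/-! ## Lebesgue measure and intervals of delays -/

lemma measurableEmbedding_coe_nnreal : MeasurableEmbedding ((↑) : ℝ≥0 → ℝ) :=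
  MeasurableEmbedding.subtype_coe (measurableSet_Ici (a := (0 : ℝ)))

lemma lebesgue_apply (S : Set ℝ≥0) : lebesgue S = volume ((↑) '' S : Set ℝ) :=
  measurableEmbedding_coe_nnreal.comap_apply _ _

lemma lebesgue_of_subsingleton {S : Set ℝ≥0} (h : S.Subsingleton) : lebesgue S = 0 := by
  rw [lebesgue_apply]
  exact (h.image _).measure_zero _

lemma lebesgue_pos_of_interior_nonempty {S : Set ℝ≥0} (h : (interior S).Nonempty) :
    0 < lebesgue S := by
  obtain ⟨a, b, hab, h⟩ := isOpen_interior.exists_Ioo_subset h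
  refine lt_of_lt_of_le ?_ (measure_mono (h.trans interior_subset))
  rw [lebesgue_apply]
  refine lt_of_lt_of_le (b := volume (Set.Ioo (a : ℝ) b)) (by simpa using hab) (measure_mono ?_)
  intro x hx
  exact ⟨⟨x, a.2.trans hx.1.le⟩, ⟨hx.1, hx.2⟩, rfl⟩

namespace TimedAutomaton

variable {L X : Type*} {A : TimedAutomaton L X}

/-- Each atomic constraint cuts out an interval of values, and every clock value, before or after
the reset, is monotone in the delay. -/
lemma ordConnected_delaysVia (s : A.State) (e : A.E) : (A.delaysVia s e).OrdConnected := by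
  have hel : ∀ {a b : ℝ≥0}, a ≤ b → ∀ x, elapse s.val a x ≤ elapse s.val b x := fun h x => by
    simp only [elapse]; gcongr
  have hre : ∀ {a b : ℝ≥0}, a ≤ b → ∀ x,
      reset e.1.resets (elapse s.val a) x ≤ reset e.1.resets (elapse s.val b) x := fun h x => by
    unfold reset; split_ifs
    · rfl
    · exact hel h x
  refine ⟨fun a ha b hb c hc => ?_⟩
  obtain ⟨a1, a2, a3, a4⟩ := exists_trans_iff.1 ha
  obtain ⟨-, b2, b3, b4⟩ := exists_trans_iff.1 hb
  exact exists_trans_iff.2 ⟨a1,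
    fun k hk => Cmp.holds_between (a2 k hk) (b2 k hk) (hel hc.1 _) (hel hc.2 _),
    fun k hk => Cmp.holds_between (a3 k hk) (b3 k hk) (hel hc.1 _) (hel hc.2 _),
    fun k hk => Cmp.holds_between (a4 k hk) (b4 k hk) (hre hc.1 _) (hre hc.2 _)⟩

/-- A finite union of intervals: either all of them have at most one point, or one contains an open
interval. This matches the two cases in the requirements on `μ`. -/
lemma finite_or_interior_delays_nonempty (s : A.State) :
    (A.delays s).Finite ∨ (interior (A.delays s)).Nonempty := by
  by_cases h : ∀ e, (A.delaysVia s e).Subsingleton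
  · exact Or.inl (Set.finite_iUnion fun e => (h e).finite)
  · simp only [not_forall, Set.not_subsingleton_iff] at h
    obtain ⟨e, he⟩ := h
    obtain ⟨a, ha, b, hb, hab⟩ := he.exists_lt
    refine Or.inr ((Set.nonempty_Ioo.2 hab).mono (interior_maximal ?_ isOpen_Ioo))
    exact (Set.Ioo_subset_Icc_self.trans ((ordConnected_delaysVia s e).out ha hb)).trans
      (Set.subset_iUnion _ e)

lemma lebesgue_delays_eq_zero_of_finite {s : A.State} (h : (A.delays s).Finite) :
    lebesgue (A.delays s) = 0 := by
  rw [lebesgue_apply]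
  exact (h.image _).measure_zero _

lemma regionDelaysVia_subset_delays [Fintype L] (s : A.State) (f : A.RegionEdge) :
    A.regionDelaysVia s f ⊆ A.delays s :=
  fun _ ⟨s', h⟩ => Set.mem_iUnion.2 ⟨f.edge, s', h.1⟩

/-! ## Measurability of events -/

instance [Countable L] [Finite X] : MeasurableSingletonClass A.State := by
  refine ⟨fun s => ?_⟩
  have : ({s} : Set A.State) = {s' | s'.loc = s.loc} ∩ ⋂ x, {s' | s'.val x = s.val x} := by
    ext s'
    simp [State.ext_iff, funext_iff]
  rw [this]
  exact (measurableSet_loc _).inter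
    (MeasurableSet.iInter fun x => measurable_val x (measurableSet_singleton _))

lemma measurableSet_state_eq [Countable L] [Finite X] {Ω : Type*} [MeasurableSpace Ω]
    {f g : Ω → A.State} (hf : Measurable f) (hg : Measurable g) : MeasurableSet {ω | f ω = g ω} := by
  have : {ω | f ω = g ω} = (⋃ ℓ, {ω | (f ω).loc = ℓ} ∩ {ω | (g ω).loc = ℓ}) ∩
      ⋂ x, {ω | (f ω).val x = (g ω).val x} := by
    ext ω
    simp [State.ext_iff, funext_iff, eq_comm]
  rw [this]
  rw [measurable_state_iff] at hf hg
  exact (MeasurableSet.iUnion fun ℓ => (hf.1 ℓ).inter (hg.1 ℓ)).inter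
    (MeasurableSet.iInter fun x => measurableSet_eq_fun (hf.2 x) (hg.2 x))

lemma measurableSet_regionState_eq [Fintype L] [Finite X] {Ω : Type*} [MeasurableSpace Ω]
    {f : Ω → A.State} (hf : Measurable f) (q : A.RegionState) :
    MeasurableSet {ω | q = A.regionState (f ω)} := by
  have : {ω | q = A.regionState (f ω)} =
      {ω | (f ω).loc = q.1} ∩ {ω | A.region (f ω).val = q.2} := by
    ext ω
    simp [regionState, Prod.ext_iff, eq_comm]
  rw [this]
  rw [measurable_state_iff] at hf
  exact (hf.1 _).inter (measurableSet_region_eq hf.2 _)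

/-- The configurations whose transition can be taken. -/
def validConfigs (A : TimedAutomaton L X) : Set A.Config :=
  {c | A.Trans c.1 c.2.1 c.2.2 (A.next c.1 c.2.1 c.2.2)}

lemma measurableSet_validConfigs [Countable L] : MeasurableSet A.validConfigs := by
  have : A.validConfigs = ⋃ e, ((fun c : A.Config => c.2.2) ⁻¹' {e}) ∩
      (fun c : A.Config => (c.1, c.2.1)) ⁻¹' {q | ∃ s', A.Trans q.1 q.2 e s'} := by
    ext c
    simp only [validConfigs, Set.mem_ofPred_eq, Set.mem_iUnion, Set.mem_inter_iff, Set.mem_preimage,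
      Set.mem_singleton_iff]
    constructor
    · exact fun h => ⟨_, rfl, _, h⟩
    · rintro ⟨e, rfl, h⟩
      exact trans_next h
  rw [this]
  exact MeasurableSet.iUnion fun e =>
    ((by fun_prop : Measurable fun c : A.Config => c.2.2) (measurableSet_singleton e)).inter
      ((by fun_prop : Measurable fun c : A.Config => (c.1, c.2.1)) (measurableSet_exists_trans e))

/-- The configurations whose transition is along `f`. -/
def edgeConfigs [Fintype L] (f : A.RegionEdge) : Set A.Config :=
  {c | A.TransAlong f c.1 c.2.1 c.2.2 (A.next c.1 c.2.1 c.2.2)}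

lemma measurableSet_edgeConfigs [Fintype L] [Finite X] (f : A.RegionEdge) :
    MeasurableSet (edgeConfigs f) := by
  have h1 : MeasurableSet {c : A.Config | f.edge = c.2.2} :=
    ((by fun_prop : Measurable fun c : A.Config => c.2.2) (measurableSet_singleton f.edge)).congr
      (by ext; simp [eq_comm])
  have h2 : MeasurableSet {c : A.Config | f.source = A.regionState c.1} :=
    measurableSet_regionState_eq measurable_fst _
  have h3 : MeasurableSet {c : A.Config | f.mid = A.region (elapse c.1.val c.2.1)} := by
    have := measurableSet_region_eq (A := A) (Ω := A.Config)
      (g := fun c => elapse c.1.val c.2.1) (fun x => (measurable_elapse x).comp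
        (by fun_prop : Measurable fun c : A.Config => (c.1, c.2.1))) f.mid
    simpa only [eq_comm] using this
  have h4 : MeasurableSet {c : A.Config | f.target = A.regionState (A.next c.1 c.2.1 c.2.2)} :=
    measurableSet_regionState_eq measurable_next _
  exact measurableSet_validConfigs.inter (h1.inter (h2.inter (h3.inter h4)))

end TimedAutomaton

/-! ### The law of one step and of the runs. -/

namespace StochasticTA

open TimedAutomaton

variable {L X : Type*} {A : TimedAutomaton L X} (S : StochasticTA A)

/-- The hypothesis on `t` ensures that the invariant holds at `s + t`, so `shift` does not take its
default value. -/
lemma zero_mem_delaysVia_shift_iff {s : A.State} {t : ℝ≥0} (ht : t ∈ A.delays s) {e : A.E} :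
    0 ∈ A.delaysVia (A.shift s t) e ↔ t ∈ A.delaysVia s e := by
  refine ⟨fun h => ?_, zero_mem_delaysVia_shift⟩
  obtain ⟨e', he'⟩ := Set.mem_iUnion.1 ht
  have h0 : ∀ v : Valuation X, elapse v 0 = v := fun v => by ext; simp [elapse]
  have h' := exists_trans_iff.1 h
  rw [h0, shift_loc, shift_val, if_pos (exists_trans_iff.1 he').2.1] at h'
  exact exists_trans_iff.2 h'

lemma p_pos_iff {s : A.State} {e : A.E} : S.p s e ≠ 0 ↔ 0 ∈ A.delaysVia s e := by
  classical
  have h2 : S.enabledWeight s ≠ ∞ := by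
    refine (ENNReal.sum_lt_top.2 fun e _ => ?_).ne
    split_ifs <;> simp
  unfold p
  split_ifs with h
  · simp [h, h2, (S.w_pos e).ne']
  · simp [h]

variable [Countable L]

lemma measurableSet_delays (s : A.State) : MeasurableSet (A.delays s) :=
  MeasurableSet.iUnion fun e => (by fun_prop : Measurable fun t : ℝ≥0 => (s, t))
    (measurableSet_exists_trans e)

lemma ae_mem_delays (s : A.State) : ∀ᵐ t ∂S.μ s, t ∈ A.delays s :=
  (mem_ae_iff_prob_eq_one (measurableSet_delays s)).2 (S.μ_delays s)

lemma lintegral_configKernel (s : A.State) {f : A.Config → ℝ≥0∞} (hf : Measurable f) :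
    ∫⁻ c, f c ∂S.configKernel s = ∫⁻ t, ∑ e, S.p (A.shift s t) e * f (s, t, e) ∂S.μ s := by
  rw [configKernel, Kernel.lintegral_id_prod hf, stepKernel,
    Kernel.lintegral_compProd _ _ _ (by fun_prop)]
  refine lintegral_congr fun t => ?_
  change ∫⁻ e, f (s, t, e) ∂(∑ e, S.p (A.shift s t) e • Measure.dirac e) = _
  rw [lintegral_finsetSum_measure]
  simp

/-- Every enabled edge has positive probability, so null events are detected at the level of delays.
-/
lemma configKernel_eq_zero_iff (s : A.State) {T : Set A.Config} (hT : MeasurableSet T) :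
    S.configKernel s T = 0 ↔ ∀ᵐ t ∂S.μ s, ∀ e, t ∈ A.delaysVia s e → (s, t, e) ∉ T := by
  have hm : Measurable (T.indicator (1 : A.Config → ℝ≥0∞)) := measurable_one.indicator hT
  rw [← lintegral_indicator_one hT, lintegral_configKernel S s hm, lintegral_eq_zero_iff]
  · refine eventually_congr ?_
    filter_upwards [S.ae_mem_delays s] with t ht
    simp only [Pi.zero_apply, Finset.sum_eq_zero_iff, Finset.mem_univ, true_imp_iff, mul_eq_zero]
    refine forall_congr' fun e => ?_
    rw [← zero_mem_delaysVia_shift_iff ht, ← S.p_pos_iff]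
    by_cases h : (s, t, e) ∈ T <;> simp [h]
  · have hsh : Measurable fun t : ℝ≥0 => A.shift s t :=
      (measurable_shift (A := A)).comp (measurable_prodMk_left (x := s))
    refine Finset.measurable_sum _ fun e _ => Measurable.mul ?_ ?_
    · exact (S.measurable_p e).comp hsh
    · exact hm.comp (by fun_prop)

lemma ae_configKernel_valid (s : A.State) : ∀ᵐ c ∂S.configKernel s, c ∈ A.validConfigs := by
  refine (S.configKernel_eq_zero_iff s measurableSet_validConfigs.compl).2 (ae_of_all _ ?_)
  intro t e ht h
  exact h (trans_next ht)

lemma ae_configKernel_fst [Finite X] (s : A.State) : ∀ᵐ c ∂S.configKernel s, c.1 = s := by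
  refine (S.configKernel_eq_zero_iff s
    (measurable_fst (measurableSet_singleton s)).compl).2 (ae_of_all _ ?_)
  intro t e _ h
  exact h rfl

lemma prob_eq_law (s : A.State) : S.prob s = MarkovChain.law (S.configKernel s) S.nextKernel := rfl

lemma ae_prob_mem_runs [Finite X] (s : A.State) : ∀ᵐ ρ ∂S.prob s, ρ ∈ A.runs s := by
  rw [prob_eq_law]
  have h0 := S.ae_configKernel_fst s
  rw [← MarkovChain.map_zero (S.configKernel s) S.nextKernel] at h0
  have h2 := MarkovChain.ae_pair (S.configKernel s) S.nextKernel
    (Q := fun c c' => c'.1 = A.next c.1 c.2.1 c.2.2)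
    (measurableSet_state_eq (measurable_fst.comp measurable_snd)
      (measurable_next.comp measurable_fst))
    (fun c => S.ae_configKernel_fst (A.next c.1 c.2.1 c.2.2))
  filter_upwards [ae_of_ae_map (measurable_pi_apply 0).aemeasurable h0, h2,
    MarkovChain.ae_forall (S.configKernel s) S.nextKernel measurableSet_validConfigs
      (S.ae_configKernel_valid s) (fun c => S.ae_configKernel_valid _)] with ρ h3 h4 h5
  refine ⟨h3, fun n => ?_⟩
  rw [h4 n]
  exact h5 n

/-! ## Probabilities of visiting a set of configurations within a bounded number of steps -/

/-- The probability that a run from `s` visits `T` at one of its first `N + 1` configurations. -/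
def visitProb (T : Set A.Config) (N : ℕ) (s : A.State) : ℝ≥0∞ :=
  ∫⁻ c, MarkovChain.hit S.nextKernel T N c ∂S.configKernel s

variable {T : Set A.Config}

lemma measurable_visitProb (hT : MeasurableSet T) (N : ℕ) : Measurable (S.visitProb T N) :=
  (MarkovChain.measurable_hit S.nextKernel hT N).lintegral_kernel

/-- `nextKernel` at `c` is `configKernel` at the successor state. The extra step on the right is `c`
itself, which `hit` also inspects. -/
lemma visitProb_next_le (N : ℕ) (c : A.Config) :
    S.visitProb T N (A.next c.1 c.2.1 c.2.2) ≤ MarkovChain.hit S.nextKernel T (N + 1) c :=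
  MarkovChain.lintegral_hit_le S.nextKernel N c

lemma prob_visits (hT : MeasurableSet T) (N : ℕ) (s : A.State) :
    S.prob s (MarkovChain.visits T 0 N) = S.visitProb T N s :=
  MarkovChain.law_visits (S.configKernel s) S.nextKernel hT N

lemma visitProb_zero (hT : MeasurableSet T) (s : A.State) :
    S.visitProb T 0 s = S.configKernel s T := by
  classical
  rw [← lintegral_indicator_one hT]
  refine lintegral_congr fun c => ?_
  simp [MarkovChain.hit, Set.indicator]

/-- An integral of nonnegative values that vanishes has an almost surely vanishing integrand; one
unit of the horizon is spent on the step. When all horizons give zero, this propagates forever. -/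
lemma ae_visitProb_next_eq_zero [Finite X] (hT : MeasurableSet T) (N : ℕ) (s : A.State) :
    ∀ᵐ ρ ∂S.prob s, ∀ n, S.visitProb T (N + 1) (ρ n).1 = 0 → S.visitProb T N (ρ (n + 1)).1 = 0 := by
  have hQ : MeasurableSet {c : A.Config | S.visitProb T (N + 1) c.1 = 0 →
      S.visitProb T N (A.next c.1 c.2.1 c.2.2) = 0} := by
    have h1 := ((S.measurable_visitProb hT (N + 1)).comp
      (measurable_fst : Measurable fun c : A.Config => c.1)) (measurableSet_singleton 0)
    have h2 := ((S.measurable_visitProb hT N).comp (measurable_next (A := A)))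
      (measurableSet_singleton 0)
    exact (measurableSet_setOfPred.1 h1).imp (measurableSet_setOfPred.1 h2) |>.setOf
  have h : ∀ s', ∀ᵐ c ∂S.configKernel s', S.visitProb T (N + 1) c.1 = 0 →
      S.visitProb T N (A.next c.1 c.2.1 c.2.2) = 0 := by
    intro s'
    by_cases h0 : S.visitProb T (N + 1) s' = 0
    · rw [visitProb, lintegral_eq_zero_iff (MarkovChain.measurable_hit _ hT _)] at h0
      filter_upwards [h0] with c hc _
      exact le_antisymm ((S.visitProb_next_le N c).trans hc.le) zero_le
    · filter_upwards [S.ae_configKernel_fst s'] with c hc h1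
      exact absurd (hc ▸ h1) h0
  filter_upwards [S.ae_prob_mem_runs s, MarkovChain.ae_forall (S.configKernel s) S.nextKernel hQ
    (h s) (fun c => h _)] with ρ h1 h2 n h3
  rw [← next_of_trans (h1.2 n)]
  exact h2 n h3

lemma frequently_atTop_succ {q : ℕ → Prop} (h : ∃ᶠ n in atTop, q n) :
    ∃ᶠ n in atTop, q (n + 1) := by
  rwa [← map_add_atTop_eq_nat 1, frequently_map] at h

/-- If the states from which `T` is visited within `N` steps with probability at least `ε` are
visited infinitely often, then so is `T`, almost surely. -/
lemma ae_frequently_mem [Finite X] (hT : MeasurableSet T) (N : ℕ) {ε : ℝ≥0∞} (hε : 0 < ε)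
    (s : A.State) :
    ∀ᵐ ρ ∂S.prob s, (∃ᶠ n in atTop, ε ≤ S.visitProb T N (ρ n).1) → ∃ᶠ n in atTop, ρ n ∈ T := by
  filter_upwards [S.ae_prob_mem_runs s,
    MarkovChain.ae_frequently_mem (S.configKernel s) S.nextKernel hT (N + 1) hε] with ρ h1 h2 h3
  -- The chain theorem conditions on a whole configuration, in which the delay and edge are already
  -- drawn. So the state at time `n + 1` is viewed from the configuration at time `n`, with horizon
  -- `N + 1`.
  refine h2 ((frequently_atTop_succ h3).mono fun n hn => hn.trans ?_)
  rw [← next_of_trans (h1.2 n)]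
  exact S.visitProb_next_le N _

end StochasticTA

/-! ## Thick edges -/

namespace StochasticTA

open TimedAutomaton

variable {L X : Type*} [Fintype L] [Finite X] {A : TimedAutomaton L X} (S : StochasticTA A)

/-- If `I(s)` is finite, each of its points has positive mass, and `I(s, f)` is nonempty by
bisimulation. Otherwise `I(s)` has interior; thickness, applied at `s` itself, gives `I(s, f)`
interior too, hence positive Lebesgue measure. -/
lemma μ_regionDelaysVia_ne_zero {f : A.RegionEdge} (hf : f.IsThick) {s : A.State}
    (hs : f.source = A.regionState s) : S.μ s (A.regionDelaysVia s f) ≠ 0 := by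
  rcases finite_or_interior_delays_nonempty s with h | h
  · obtain ⟨t, ht⟩ := regionDelaysVia_nonempty hs
    intro h0
    have h1 := (S.μ_of_zero s (lebesgue_delays_eq_zero_of_finite h)).2 h0
    rw [uniformOn_eq_zero_iff h] at h1
    exact Set.eq_empty_iff_forall_notMem.1 h1 t ⟨regionDelaysVia_subset_delays s f ht, ht⟩
  · have h1 : (interior (A.regionDelaysVia s f)).Nonempty := by
      by_contra hn
      exact hf ⟨s, hs.symm, by simp [dim, h, hn]⟩
    intro h0
    have h2 := (S.μ_of_pos s (lebesgue_pos_of_interior_nonempty h)).2 h0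
    refine (lebesgue_pos_of_interior_nonempty h1).ne' (le_antisymm ?_ zero_le)
    rw [← h2, Measure.restrict_apply' (measurableSet_delays s),
      Set.inter_eq_left.2 (regionDelaysVia_subset_delays s f)]

lemma visitProb_edgeConfigs_ne_zero {f : A.RegionEdge} (hf : f.IsThick) {s : A.State}
    (hs : f.source = A.regionState s) : S.visitProb (edgeConfigs f) 0 s ≠ 0 := by
  rw [S.visitProb_zero (measurableSet_edgeConfigs f), Ne,
    S.configKernel_eq_zero_iff s (measurableSet_edgeConfigs f)]
  intro h
  refine S.μ_regionDelaysVia_ne_zero hf hs (measure_mono_null ?_ h)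
  rintro t ⟨s', hs'⟩ ht
  refine ht f.edge ⟨s', hs'.1⟩ ?_
  simp only [edgeConfigs, Set.mem_ofPred_eq]
  rwa [next_of_trans hs'.1]

end StochasticTA

end STA

end

noncomputable section

namespace STA

open TimedAutomaton

/-! ## States that agree up to the values above the maximal constant -/

namespace TimedAutomaton

variable {L X : Type*} [Fintype L] {A : TimedAutomaton L X}

/-- `v` and `v'` agree on each clock, unless both values are above the maximal constant. -/
def Agree (A : TimedAutomaton L X) (v v' : Valuation X) : Prop :=
  ∀ x, v x = v' x ∨ (A.maxConst : ℝ≥0) < min (v x) (v' x)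

lemma Agree.regionEquiv {v v' : Valuation X} (h : A.Agree v v') : A.RegionEquiv v v' := by
  refine ⟨fun x => ?_, fun x y hx hy => ?_⟩
  · rcases h x with h1 | h1
    · exact Or.inr (by simp [h1])
    · exact Or.inl (lt_min_iff.1 h1)
  · have key : ∀ z, v z ≤ A.maxConst → v z = v' z := fun z hz =>
      (h z).resolve_right fun h1 => not_le.2 (lt_min_iff.1 h1).1 hz
    rw [key x hx, key y hy]

lemma Agree.elapse {v v' : Valuation X} (h : A.Agree v v') (t : ℝ≥0) :
    A.Agree (elapse v t) (elapse v' t) := by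
  intro x
  rcases h x with h1 | h1
  · exact Or.inl (by simp [STA.elapse, h1])
  · rw [lt_min_iff] at h1
    exact Or.inr (lt_min (h1.1.trans_le le_self_add) (h1.2.trans_le le_self_add))

lemma Agree.reset {v v' : Valuation X} (h : A.Agree v v') (Y : Set X) :
    A.Agree (reset Y v) (reset Y v') := by
  intro x
  by_cases hx : x ∈ Y
  · simp [STA.reset, hx]
  · simpa [STA.reset, hx] using h x

lemma Agree.symm {v v' : Valuation X} (h : A.Agree v v') : A.Agree v' v := fun x => by
  rw [eq_comm, min_comm]; exact h x

/-- States with the same location whose valuations agree up to the values above the maximal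
constant. -/
def AgreeState (s s' : A.State) : Prop := s.loc = s'.loc ∧ A.Agree s.val s'.val

lemma AgreeState.regionState_eq {s s' : A.State} (h : AgreeState s s') :
    A.regionState s = A.regionState s' :=
  Prod.ext h.1 (Quotient.sound h.2.regionEquiv)

lemma AgreeState.exists_trans_iff {s s' : A.State} (h : AgreeState s s') (t : ℝ≥0) (e : A.E) :
    (∃ u, A.Trans s t e u) ↔ ∃ u, A.Trans s' t e u :=
  ⟨exists_trans_of_regionEquiv h.1 (h.2.elapse t).regionEquiv,
    exists_trans_of_regionEquiv h.1.symm (h.2.symm.elapse t).regionEquiv⟩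

lemma AgreeState.next {s s' : A.State} (h : AgreeState s s') (t : ℝ≥0) (e : A.E) :
    AgreeState (A.next s t e) (A.next s' t e) := by
  by_cases ht : ∃ u, A.Trans s t e u
  · have h1 := trans_next ht
    have h2 := trans_next ((h.exists_trans_iff t e).1 ht)
    refine ⟨h1.2.2.2.1.trans h2.2.2.2.1.symm, ?_⟩
    rw [h1.2.2.2.2, h2.2.2.2.2]
    exact (h.2.elapse t).reset _
  · have ht' := fun h' => ht ((h.exists_trans_iff t e).2 h')
    rwa [TimedAutomaton.next, TimedAutomaton.next, dif_neg ht, dif_neg ht']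

lemma AgreeState.shift {s s' : A.State} (h : AgreeState s s') (t : ℝ≥0) :
    AgreeState (A.shift s t) (A.shift s' t) := by
  refine ⟨by rw [shift_loc, shift_loc, h.1], ?_⟩
  have hiff : Sat (STA.elapse s.val t) (A.inv s.loc) ↔ Sat (STA.elapse s'.val t) (A.inv s'.loc) := by
    rw [h.1]
    exact (h.2.elapse t).regionEquiv.sat_iff fun _ => const_le_of_mem_inv _
  rw [shift_val, shift_val]
  by_cases h1 : Sat (STA.elapse s.val t) (A.inv s.loc)
  · rw [if_pos h1, if_pos (hiff.1 h1)]
    exact h.2.elapse t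
  · rw [if_neg h1, if_neg (fun h' => h1 (hiff.2 h'))]
    exact h.2

lemma AgreeState.mem_edgeConfigs_iff {s s' : A.State} (h : AgreeState s s') (f : A.RegionEdge)
    (t : ℝ≥0) (e : A.E) : (s, t, e) ∈ edgeConfigs f ↔ (s', t, e) ∈ edgeConfigs f := by
  have h1 : A.Trans s t e (A.next s t e) ↔ A.Trans s' t e (A.next s' t e) :=
    ⟨fun h' => trans_next ((h.exists_trans_iff t e).1 ⟨_, h'⟩),
      fun h' => trans_next ((h.exists_trans_iff t e).2 ⟨_, h'⟩)⟩
  have h2 : A.region (STA.elapse s.val t) = A.region (STA.elapse s'.val t) :=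
    Quotient.sound (h.2.elapse t).regionEquiv
  simp only [edgeConfigs, TransAlong, Set.mem_ofPred_eq, h1, h.regionState_eq, h2,
    (h.next t e).regionState_eq]

/-- The states all of whose clocks are zero or above the maximal constant. -/
def extremalStates (A : TimedAutomaton L X) : Set A.State :=
  {s | ∀ x, s.val x = 0 ∨ (A.maxConst : ℝ≥0) < s.val x}

/-- Up to agreement there are only finitely many extremal states: this makes the pigeonhole argument
possible. -/
lemma agreeState_of_mem_extremalStates {s s' : A.State} (hs : s ∈ A.extremalStates)
    (hs' : s' ∈ A.extremalStates) (hloc : s.loc = s'.loc)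
    (h : {x | s.val x = 0} = {x | s'.val x = 0}) : AgreeState s s' := by
  refine ⟨hloc, fun x => ?_⟩
  have hx : s.val x = 0 ↔ s'.val x = 0 := Set.ext_iff.1 h x
  by_cases h0 : s.val x = 0
  · exact Or.inl (h0.trans (hx.1 h0).symm)
  · exact Or.inr (lt_min ((hs x).resolve_left h0)
      ((hs' x).resolve_left fun h' => h0 (hx.2 h')))

lemma Trans.mem_extremalStates {s s' : A.State} {t : ℝ≥0} {e : A.E} (h : A.Trans s t e s')
    (ht : (A.maxConst : ℝ≥0) < t) : s' ∈ A.extremalStates := by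
  intro x
  rw [h.2.2.2.2]
  by_cases hx : x ∈ e.1.resets
  · simp [STA.reset, hx]
  · right
    simp only [STA.reset, hx, if_false, STA.elapse]
    exact ht.trans_le le_add_self

end TimedAutomaton

namespace StochasticTA

variable {L X : Type*} [Fintype L] {A : TimedAutomaton L X} (S : StochasticTA A)

lemma p_congr {s s' : A.State} (h : AgreeState s s') (e : A.E) : S.p s e = S.p s' e := by
  classical
  have h1 : ∀ e, 0 ∈ A.delaysVia s e ↔ 0 ∈ A.delaysVia s' e := fun e => h.exists_trans_iff 0 e
  have h2 : S.enabledWeight s = S.enabledWeight s' :=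
    Finset.sum_congr rfl fun e _ => if_congr (h1 e) rfl rfl
  rw [p, p, h2]
  exact if_congr (h1 e) rfl rfl

/-- With the same delay and edge, agreeing states move to agreeing states through the same regions.
The delay laws and edge probabilities coincide as well, so induction on `N` applies. -/
lemma visitProb_edgeConfigs_congr [Finite X] (hμ : ∀ s s' : A.State, AgreeState s s' → S.μ s = S.μ s')
    (f : A.RegionEdge) (N : ℕ) {s s' : A.State} (h : AgreeState s s') :
    S.visitProb (edgeConfigs f) N s = S.visitProb (edgeConfigs f) N s' := by
  classical
  have hT := measurableSet_edgeConfigs f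
  induction N generalizing s s' with
  | zero =>
    have hhit : ∀ t e, MarkovChain.hit S.nextKernel (edgeConfigs f) 0 (s, t, e) =
        MarkovChain.hit S.nextKernel (edgeConfigs f) 0 (s', t, e) :=
      fun t e => if_congr (h.mem_edgeConfigs_iff f t e) rfl rfl
    simp only [visitProb, S.lintegral_configKernel _ (MarkovChain.measurable_hit S.nextKernel hT _),
      hμ s s' h, hhit, S.p_congr (h.shift _)]
  | succ N ih =>
    have hhit : ∀ t e, MarkovChain.hit S.nextKernel (edgeConfigs f) (N + 1) (s, t, e) =
        MarkovChain.hit S.nextKernel (edgeConfigs f) (N + 1) (s', t, e) :=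
      fun t e => if_congr (h.mem_edgeConfigs_iff f t e) rfl (ih (h.next t e))
    simp only [visitProb, S.lintegral_configKernel _ (MarkovChain.measurable_hit S.nextKernel hT _),
      hμ s s' h, hhit, S.p_congr (h.shift _)]

lemma configKernel_delay (s : A.State) {D : Set ℝ≥0} (hD : MeasurableSet D) :
    S.configKernel s {c | c.2.1 ∈ D} = S.μ s D := by
  have hT : MeasurableSet {c : A.Config | c.2.1 ∈ D} :=
    (by fun_prop : Measurable fun c : A.Config => c.2.1) hD
  rw [← lintegral_indicator_one hT, ← lintegral_indicator_one hD,
    S.lintegral_configKernel s (measurable_one.indicator hT)]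
  refine lintegral_congr_ae ?_
  filter_upwards [S.ae_mem_delays s] with t ht
  obtain ⟨e, he⟩ := Set.mem_iUnion.1 ht
  by_cases h : t ∈ D
  · simpa [h] using S.sum_p _ ⟨e, zero_mem_delaysVia_shift he⟩
  · simp [h]

/-! ### Recurrence and fairness for weak reactive automata. -/

namespace IsWeakReactive

variable {S} (hS : S.IsWeakReactive)
include hS

lemma μ_congr {s s' : A.State} (h : AgreeState s s') : S.μ s = S.μ s' := hS.μ_eq s s' h.1 h.2

variable [Finite X]

/-- From every state `L_u` is visited within `N` steps with probability at least `λ₁`: at once from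
`L_u`, by condition 3 otherwise. -/
lemma ae_frequently_unboundedLocs (s : A.State) :
    ∀ᵐ ρ ∂S.prob s, ∃ᶠ n in atTop, (ρ n).1.loc ∈ A.unboundedLocs := by
  classical
  obtain ⟨lam, hlam, hlam1, N, -, h⟩ := hS.bounded
  set T : Set A.Config := {c | c.1.loc ∈ A.unboundedLocs}
  have hT : MeasurableSet T := by
    have : T = ⋃ ℓ ∈ A.unboundedLocs, Prod.fst ⁻¹' {s : A.State | s.loc = ℓ} := by
      ext; simp [T]
    rw [this]
    exact MeasurableSet.biUnion (Set.to_countable _) fun ℓ _ => measurable_fst (measurableSet_loc ℓ)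
  have key : ∀ s', (lam : ℝ≥0∞) ≤ S.visitProb T N s' := by
    intro s'
    by_cases hs' : s'.loc ∈ A.unboundedLocs
    · have : S.visitProb T N s' = ∫⁻ _, 1 ∂S.configKernel s' := by
        refine lintegral_congr_ae ?_
        filter_upwards [S.ae_configKernel_fst s'] with c hc
        have hcT : c ∈ T := by simpa [T, hc] using hs'
        cases N <;> simp [MarkovChain.hit, hcT]
      rw [this]
      simpa using hlam1
    · refine (h s' hs').trans ?_
      rw [← S.prob_visits hT]
      refine measure_mono ?_
      rintro ρ hρ
      simp only [Set.mem_iUnion] at hρ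
      obtain ⟨es, ⟨i, hi, hi'⟩, hρ1, hρ2⟩ := hρ
      -- The edge with index `i`, counted from `0`, leads to the state of configuration `i + 1`.
      refine ⟨i + 1, hi.le, ?_⟩
      have := (hρ1.2 i).2.2.2.1
      rw [hρ2 i] at this
      simp only [T, Set.mem_ofPred_eq, zero_add]
      rwa [this]
  filter_upwards [S.ae_frequently_mem hT N (ENNReal.coe_pos.2 hlam) s] with ρ hρ
  exact hρ (Frequently.of_forall fun n => key _)

lemma ae_frequently_lt_delay (s : A.State) :
    ∀ᵐ ρ ∂S.prob s, ∃ᶠ n in atTop, (A.maxConst : ℝ≥0) < (ρ n).2.1 := by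
  obtain ⟨lam, hlam, -, h⟩ := hS.unbounded
  have hT : MeasurableSet {c : A.Config | c.2.1 ∈ Set.Ioi (A.maxConst : ℝ≥0)} :=
    (by fun_prop : Measurable fun c : A.Config => c.2.1) measurableSet_Ioi
  filter_upwards [hS.ae_frequently_unboundedLocs s,
    S.ae_frequently_mem hT 0 (ENNReal.coe_pos.2 hlam) s] with ρ h1 h2
  refine h2 (h1.mono fun n hn => ?_)
  rw [S.visitProb_zero hT, S.configKernel_delay _ measurableSet_Ioi]
  refine (h _ hn).trans (measure_mono_ae ?_)
  -- Condition 2 concerns `[M, ∞)`, whereas a strict inequality is needed. An unbounded `I(s)` is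
  -- not finite, so `μ_s` is absolutely continuous and does not charge `M`.
  have hpos : 0 < lebesgue (A.delays (ρ n).1) := by
    rcases finite_or_interior_delays_nonempty (ρ n).1 with hfin | hint
    · exact absurd hfin.bddAbove (hn _ rfl)
    · exact lebesgue_pos_of_interior_nonempty hint
  have h0 : S.μ (ρ n).1 {(A.maxConst : ℝ≥0)} = 0 :=
    (S.μ_of_pos _ hpos).1 (le_antisymm ((Measure.restrict_apply_le _ _).trans
      (lebesgue_of_subsingleton Set.subsingleton_singleton).le) zero_le)
  filter_upwards [measure_eq_zero_iff_ae_notMem.1 h0] with t ht ht'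
  exact lt_of_le_of_ne ht' fun h => ht h.symm

lemma ae_frequently_extremalStates (s : A.State) :
    ∀ᵐ ρ ∂S.prob s, ∃ᶠ n in atTop, (ρ n).1 ∈ A.extremalStates := by
  filter_upwards [hS.ae_frequently_lt_delay s, S.ae_prob_mem_runs s] with ρ h1 h2
  have h3 := h1.mono fun n hn => (h2.2 n).mem_extremalStates hn
  rw [← map_add_atTop_eq_nat 1, frequently_map]
  exact h3

/-- Weak reactive stochastic timed automata are almost-surely fair. -/
theorem almostSurelyFair (s : A.State) : S.AlmostSurelyFair s := by
  suffices h : ∀ᵐ ρ ∂S.prob s, ρ ∈ A.runs s ∧ A.IsFair ρ by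
    refine le_antisymm ((measure_mono (Set.subset_univ _)).trans ?_) ?_
    · rw [prob_eq_law]; exact measure_univ.le
    · have h1 : (S.prob s) Set.univ = 1 := by rw [prob_eq_law]; exact measure_univ
      rw [← h1]
      exact (measure_mono_ae (by filter_upwards [h] with ρ hρ _ using hρ))
  -- The threshold will depend on the run, so it ranges over the countable family `1 / (k + 1)`.
  have hrec : ∀ᵐ ρ ∂S.prob s, ∀ (f : A.RegionEdge) (N k : ℕ),
      (∃ᶠ n in atTop, ((k : ℝ≥0∞) + 1)⁻¹ ≤ S.visitProb (edgeConfigs f) N (ρ n).1) →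
        ∃ᶠ n in atTop, ρ n ∈ edgeConfigs f :=
    ae_all_iff.2 fun f => ae_all_iff.2 fun N => ae_all_iff.2 fun k =>
      S.ae_frequently_mem (measurableSet_edgeConfigs f) N (by simp) s
  have habs : ∀ᵐ ρ ∂S.prob s, ∀ (f : A.RegionEdge) (N n : ℕ),
      S.visitProb (edgeConfigs f) (N + 1) (ρ n).1 = 0 →
        S.visitProb (edgeConfigs f) N (ρ (n + 1)).1 = 0 :=
    ae_all_iff.2 fun f => ae_all_iff.2 fun N =>
      S.ae_visitProb_next_eq_zero (measurableSet_edgeConfigs f) N s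
  filter_upwards [S.ae_prob_mem_runs s, hrec, habs, hS.ae_frequently_extremalStates s]
    with ρ hrun hrec habs hext
  refine ⟨hrun, fun f hf hsource => ?_⟩
  suffices h : ∃ᶠ n in atTop, ρ n ∈ edgeConfigs f by
    refine h.mono fun n hn => ?_
    simp only [edgeConfigs, Set.mem_ofPred_eq, next_of_trans (hrun.2 n)] at hn
    exact hn
  -- Pigeonhole over the finitely many pairs of a location and a set of zero clocks.
  obtain ⟨⟨ℓ, Y⟩, hc⟩ : ∃ c : L × Set X, ∃ᶠ n in atTop, (ρ n).1 ∈ A.extremalStates ∧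
      ((ρ n).1.loc, {x | (ρ n).1.val x = 0}) = c := by
    by_contra! hno
    obtain ⟨n, hn1, hn2⟩ := (hext.and_eventually (eventually_all.2 hno)).exists
    exact hn2 _ hn1 rfl
  obtain ⟨m, hm, hmc⟩ := hc.exists
  have hagree : ∃ᶠ n in atTop, AgreeState (ρ m).1 (ρ n).1 := hc.mono fun n hn => by
    have h1 := hmc.trans hn.2.symm
    simp only [Prod.mk.injEq] at h1
    exact agreeState_of_mem_extremalStates hm hn.1 h1.1 h1.2
  -- The state at time `m` represents the recurring class, so this alternative decides for all its
  -- visits.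
  by_cases h0 : ∀ N, S.visitProb (edgeConfigs f) N (ρ m).1 = 0
  · exfalso
    have hz : ∀ k N, S.visitProb (edgeConfigs f) N (ρ (m + k)).1 = 0 := by
      intro k
      induction k with
      | zero => exact h0
      | succ k ih => exact fun N => habs f N (m + k) (ih (N + 1))
    obtain ⟨n, hn1, hn2⟩ := (hsource.and_eventually (eventually_ge_atTop m)).exists
    obtain ⟨k, rfl⟩ := Nat.exists_eq_add_of_le hn2
    exact S.visitProb_edgeConfigs_ne_zero hf hn1 (hz k 0)
  · push Not at h0
    obtain ⟨N, hN⟩ := h0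
    obtain ⟨k, hk⟩ := ENNReal.exists_inv_nat_lt hN
    refine hrec f N k (hagree.mono fun n hn => ?_)
    rw [← S.visitProb_edgeConfigs_congr (fun _ _ => hS.μ_congr) f N hn]
    exact (ENNReal.inv_le_inv.2 le_self_add).trans hk.le

end IsWeakReactive

/-- Reactive stochastic timed automata are weak reactive. -/
theorem IsReactive.isWeakReactive {S : StochasticTA A} (hS : S.IsReactive) : S.IsWeakReactive := by
  obtain ⟨hA, hm⟩ := hS
  choose m hprob hequiv hμ using hm
  have hall : ∀ ℓ, ℓ ∈ A.unboundedLocs := fun ℓ s _ => by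
    rw [hA s]; exact not_bddAbove_univ
  -- Condition 3 is vacuous as `L_b` is empty, so `λ₁ = 1` and `N = 1` are arbitrary.
  refine ⟨fun s s' h _ => (hμ _ s h).trans (hμ _ s' rfl).symm, ?_,
    1, one_pos, le_rfl, 1, le_rfl, fun s hs => absurd (hall _) hs⟩
  have hpos : ∀ ℓ, m ℓ (Set.Ici (A.maxConst : ℝ≥0)) ≠ 0 := fun ℓ h0 => by
    refine (lebesgue_pos_of_interior_nonempty (S := Set.Ici (A.maxConst : ℝ≥0)) ?_).ne'
      ((hequiv ℓ).2 h0)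
    exact ⟨A.maxConst + 1, interior_maximal Set.Ioi_subset_Ici_self isOpen_Ioi
      (Set.mem_Ioi.2 (lt_add_of_pos_right _ one_pos))⟩
  have hfin : ∀ ℓ, m ℓ (Set.Ici (A.maxConst : ℝ≥0)) ≠ ∞ := fun ℓ =>
    have := hprob ℓ
    measure_ne_top _ _
  by_cases hL : Nonempty L
  -- `λ₀` is the least mass of `[M, ∞)` over the locations; it is positive because each `μ_ℓ` is
  -- equivalent to Lebesgue measure.
  · obtain ⟨ℓ₀, h₀⟩ := Finite.exists_min fun ℓ => (m ℓ (Set.Ici (A.maxConst : ℝ≥0))).toNNReal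
    refine ⟨_, ENNReal.toNNReal_pos (hpos ℓ₀) (hfin ℓ₀), ?_, fun s _ => ?_⟩
    · have := hprob ℓ₀
      rw [← ENNReal.coe_le_coe, ENNReal.coe_toNNReal (hfin ℓ₀)]
      exact prob_le_one
    · rw [hμ _ s rfl, ← ENNReal.coe_toNNReal (hfin s.loc)]
      exact ENNReal.coe_le_coe.2 (h₀ s.loc)
  · exact ⟨1, one_pos, le_rfl, fun s _ => absurd ⟨s.loc⟩ hL⟩

end StochasticTA

end STA

end

theorem mainTheorem7 {L X : Type*} [Fintype L] [Fintype X] (A : STA.TimedAutomaton L X)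
    (S : STA.StochasticTA A) :
    (S.IsWeakReactive → ∀ s : A.State, S.AlmostSurelyFair s) ∧
      (S.IsReactive → S.IsWeakReactive ∧ ∀ s : A.State, S.AlmostSurelyFair s) :=
  ⟨fun h s => h.almostSurelyFair s,
    fun h => ⟨h.isWeakReactive, fun s => h.isWeakReactive.almostSurelyFair s⟩⟩
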